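/- Let $\alpha>-1$, $f(k)=k+\alpha$, $\beta\in[0,1)$, and let $\mu$ be a probability measure on $[0,\infty)$; let $\xi$ have law $\mu$, and write $\lfloor x\rfloor_+=\max\{\lfloor x\rfloor,1\}$. Consider random trees $\mathcal T(1),\mathcal T(2),\dots$, where $\mathcal T(n)$ has vertices $1,\dots,n$: vertex $2$ is attached to vertex $1$; for $n\ge2$ a delay $\xi_{n+1}$ with law $\mu$, independent of the labelled tree $\mathcal T(n)$, is sampled and, given $\mathcal T(n)$ and $\xi_{n+1}$, vertex $n+1$ is attached to a vertex $v$ of $\mathcal T(m)$, $m=\lfloor n-n^\beta\xi_{n+1}\rfloor_+$, with probability proportional to $f(\deg(v,m))$. Here $\deg(v,m)$ is the degree of $v$ in $\mathcal T(m)$, with $\deg(1,1):=1$. Let $N_1(n)$ be the number of vertices of degree $1$ in $\mathcal T(n)$. Let $\lambda^*$ be the unique $\lambda>0$ with $\sum_{k\ge1}\prod_{i=1}^k\frac{f(i)}{\lambda+f(i)}=1$ (so $\lambda^*=2+\alpha$) and let $p_1=\frac{\lambda^*}{\lambda^*+f(1)}=\frac{2+\alpha}{3+2\alpha}$. Assume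 $$\lim_{n\to\infty}\mathbb E\left[\frac{n^\beta\xi\,\mathbf 1\{n-n^\beta\xi\ge1\}}{\lfloor n-n^\beta\xi\rfloor_+}\right]=0 .$$ Put $\gamma=\frac{1+\alpha}{2+\alpha}$ and, for $n\ge1$, $$k_n=1-\gamma\,\mathbb E\left[\frac{\mathbf 1\{n-n^\beta\xi\ge1\}}{\lfloor n-n^\beta\xi\rfloor}\right],$$ $$A_n=1+\gamma\sum_{i=1}^n\mathbf 1\{\deg(i,n)=1\}\,\mathbb E\left[\frac{\mathbf 1\{1\le n-n^\beta\xi<i\}}{\lfloor n-n^\beta\xi\rfloor}\right]-\mathbf 1\{\deg(1,n)=1\}\,\mathbb P(n-n^\beta\xi<1),$$ and define the random centering by $\mathfrak X_1=0$, $\mathfrak X_{n+1}=k_n\mathfrak X_n+A_n$, that is, $\mathfrak X_n=\sum_{i=1}^{n-1}\bigl(\prod_{j=i+1}^{n-1}k_j\bigr)A_i$ (the expectations and the probability in $k_n$ and $A_n$ are over $\xi\sim\mu$ only, with the tree held fixed). Then $\mathfrak X_n/n\to p_1$ almost surely, and $$\sqrt n\left(\frac{N_1(n)}{n}-\frac{\mathfrak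 X_n}{n}\right)\xrightarrow{d}\mathcal N\left(0,\frac{(1+\alpha)(2+\alpha)^2}{(3+2\alpha)^2(4+3\alpha)}\right).$$ If in addition $\sqrt n\,\mathbb E\left[\frac{n^\beta\xi\,\mathbf 1\{n-n^\beta\xi\ge1\}}{\lfloor n-n^\beta\xi\rfloor}\right]\to0$, then also $$\sqrt n\left(\frac{N_1(n)}{n}-p_1\right)\xrightarrow{d}\mathcal N\left(0,\frac{(1+\alpha)(2+\alpha)^2}{(3+2\alpha)^2(4+3\alpha)}\right).$$ -/

import Mathlib

open MeasureTheory ProbabilityTheory Filter Topology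

/-! ### Recursive trees encoded by their parent sequence

The vertices are labelled `1, 2, 3, …`; vertex `1` is the root, vertex `j ≥ 2` enters at time `j`
and is joined by an edge to the vertex `p j`.  The tree at time `n` has the vertices `1, …, n` and
the edges `{j, p j}` for `2 ≤ j ≤ n`. -/

/-- The number of children of `v` in the tree at time `n`. -/
def inDegree (p : ℕ → ℕ) (v n : ℕ) : ℕ :=
  ((Finset.Icc 2 n).filter (fun j => p j = v)).card

/-- The degree of vertex `v` at time `n`: it is `0` before `v` enters, the number of children for
the root at the times `n ≥ 2`, and the number of children plus one (the edge to the parent) for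
the other vertices.  At time `1`, when the root is alone, its degree is `1` by convention. -/
def deg (p : ℕ → ℕ) (v n : ℕ) : ℕ :=
  if n < v then 0
  else if v = 1 ∧ 2 ≤ n then inDegree p v n
  else inDegree p v n + 1

/-- `N_k(n)`: the number of vertices of degree `k` at time `n`. -/
def degreeCount (p : ℕ → ℕ) (k n : ℕ) : ℕ :=
  ((Finset.Icc 1 n).filter (fun v => deg p v n = k)).card

/-! ### Network evolution with delay -/

/-- `⌊x⌋₊ = max {⌊x⌋, 1}`. -/
noncomputable def floorPlus (x : ℝ) : ℕ := max ⌊x⌋₊ 1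

/-- The time whose tree is visible to the vertex entering at time `n + 1` with normalized
delay `x`. -/
noncomputable def infoTime (β : ℝ) (n : ℕ) (x : ℝ) : ℕ :=
  floorPlus ((n : ℝ) - (n : ℝ) ^ β * x)

/-- The probability with which a new vertex that sees the tree at time `m` is attached to `v`:
proportional to `f` of the degree at time `m`, among the vertices `1, …, m`. -/
noncomputable def attachProb (f : ℕ → ℝ) (p : ℕ → ℕ) (m v : ℕ) : ℝ :=
  if v ∈ Finset.Icc 1 m then f (deg p v m) / ∑ u ∈ Finset.Icc 1 m, f (deg p u m) else 0

/-- The labelled tree at time `n`, as the random vector of the parents of the vertices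
`2, …, n`. -/
def treeAt {Ω : Type*} (par : ℕ → Ω → ℕ) (n : ℕ) (ω : Ω) : Finset.Icc 2 n → ℕ :=
  fun j => par j ω

/-- The random trees given by the parents `par j`, `j ≥ 2`, evolve with the delays `ξ`, i.e. they
have the law `𝓛(β, μ, f)`: vertex `2` is attached to the root; for `n ≥ 2` the delay `ξ (n + 1)`
has the law `μ` and is independent of the tree at time `n`; and, given this tree and the delay,
vertex `n + 1` is attached to a vertex `v` of the tree at the visible time with probability
proportional to `f` of the degree of `v` at that time. -/
structure IsDelayedNetwork {Ω : Type*} [MeasurableSpace Ω] (P : Measure Ω) (β : ℝ)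
    (μ : Measure ℝ) (f : ℕ → ℝ) (ξ : ℕ → Ω → ℝ) (par : ℕ → Ω → ℕ) : Prop where
  measurable_delay : ∀ n, Measurable (ξ n)
  measurable_parent : ∀ n, Measurable (par n)
  parent_two : ∀ᵐ ω ∂P, par 2 ω = 1
  delay_law : ∀ n, 2 ≤ n → P.map (ξ (n + 1)) = μ
  delay_indep : ∀ n, 2 ≤ n → IndepFun (ξ (n + 1)) (treeAt par n) P
  attach : ∀ n, 2 ≤ n → ∀ v : ℕ,
    P[{ω | par (n + 1) ω = v}.indicator (fun _ => (1 : ℝ)) |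
        MeasurableSpace.comap (fun ω => (treeAt par n ω, ξ (n + 1) ω)) inferInstance]
      =ᵐ[P] fun ω => attachProb f (fun j => par j ω) (infoTime β n (ξ (n + 1) ω)) v

/-- The affine attachment function `f(k) = k + α`. -/
def affine (α : ℝ) (k : ℕ) : ℝ := (k : ℝ) + α

/-- `E[n^β ξ 1{n - n^β ξ ≥ 1} / ⌊n - n^β ξ⌋₊]` for `ξ` with law `μ` (on the event in the indicator
`⌊·⌋₊` is the ordinary integer part). -/
noncomputable def delayCost (β : ℝ) (μ : Measure ℝ) (n : ℕ) : ℝ :=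
  ∫ x, {x : ℝ | 1 ≤ (n : ℝ) - (n : ℝ) ^ β * x}.indicator
    (fun x => (n : ℝ) ^ β * x / (infoTime β n x : ℝ)) x ∂μ

/-! ### The limiting degree distribution -/

/-- `ρ̂(λ) = ∑_{k ≥ 1} ∏_{i=1}^k f(i) / (λ + f(i))`, a value in `[0, ∞]`. -/
noncomputable def rhoHat (f : ℕ → ℝ) (lam : ℝ) : ENNReal :=
  ∑' k : ℕ, ENNReal.ofReal (∏ i ∈ Finset.range (k + 1), f (i + 1) / (lam + f (i + 1)))

/-- `λ*(f)`: the Malthusian parameter, i.e. the solution `λ ∈ (0, ∞)` of `ρ̂(λ) = 1`. -/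
noncomputable def malthusian (f : ℕ → ℝ) : ℝ :=
  Classical.epsilon (fun lam : ℝ => 0 < lam ∧ rhoHat f lam = 1)

/-- `p_k(f) = λ* / (λ* + f(k)) · ∏_{1 ≤ j < k} f(j) / (λ* + f(j))`. -/
noncomputable def limitDegree (f : ℕ → ℝ) (k : ℕ) : ℝ :=
  malthusian f / (malthusian f + f k) *
    ∏ j ∈ Finset.Ico 1 k, f j / (malthusian f + f j)

/-- For `α > -1` the Malthusian parameter of `f(k) = k + α` exists, is unique and equals
`2 + α`. -/
theorem rhoHat_affine_eq_one_iff {α : ℝ} (hα : -1 < α) (lam : ℝ) :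
    (0 < lam ∧ rhoHat (affine α) lam = 1) ↔ lam = 2 + α := by
  have hf : ∀ i : ℕ, 0 < affine α (i + 1) := by
    intro i
    have : (0 : ℝ) ≤ i := Nat.cast_nonneg i
    simp only [affine]; push_cast; linarith
  -- the partial sums at `2 + α` telescope
  set v : ℕ → ℝ := fun K => ∏ i ∈ Finset.range K, ((i + 2 + α) / (i + 3 + 2 * α)) with hv
  have hpos3 : ∀ i : ℕ, (0 : ℝ) < i + 3 + 2 * α := fun i => by
    have : (0 : ℝ) ≤ i := Nat.cast_nonneg i
    linarith
  have hprod : ∀ K : ℕ, (∏ i ∈ Finset.range (K + 1),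
      affine α (i + 1) / ((2 + α) + affine α (i + 1))) * (K + 2 + α) = (1 + α) * v (K + 1) := by
    intro K
    induction K with
    | zero =>
      have := hpos3 0
      simp [affine, hv] at this ⊢
      have h2 : 2 + α + (1 + α) = 3 + 2 * α := by ring
      rw [h2]
      field_simp
    | succ K ih =>
      rw [Finset.prod_range_succ, hv]
      simp only
      rw [Finset.prod_range_succ _ (K + 1)]
      have h3 := hpos3 (K + 1)
      have h2 : (2 + α) + affine α (K + 1 + 1) = ((K + 1 : ℕ) : ℝ) + 3 + 2 * α := by
        simp only [affine]; push_cast; ring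
      rw [h2]
      have h4 : affine α (K + 1 + 1) = K + 2 + α := by
        simp only [affine]; push_cast; ring
      rw [h4]
      calc _ = ((∏ i ∈ Finset.range (K + 1),
          affine α (i + 1) / ((2 + α) + affine α (i + 1))) * (K + 2 + α)) *
          ((((K + 1 : ℕ) : ℝ) + 2 + α) / (((K + 1 : ℕ) : ℝ) + 3 + 2 * α)) := by ring
        _ = _ := by rw [ih]; ring
  have hsum : ∀ K : ℕ, ∑ k ∈ Finset.range K, (∏ i ∈ Finset.range (k + 1),
      affine α (i + 1) / ((2 + α) + affine α (i + 1))) = 1 - v K := by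
    intro K
    induction K with
    | zero => simp [hv]
    | succ K ih =>
      rw [Finset.sum_range_succ, ih]
      have h1 := hprod K
      have h2 : (0 : ℝ) < K + 2 + α := by
        have : (0 : ℝ) ≤ K := Nat.cast_nonneg K
        linarith
      have h3 : v (K + 1) = v K * ((K + 2 + α) / (K + 3 + 2 * α)) := by
        simp only [hv]; rw [Finset.prod_range_succ]
      have h4 := hpos3 K
      have h5 : (∏ i ∈ Finset.range (K + 1),
          affine α (i + 1) / ((2 + α) + affine α (i + 1))) = (1 + α) * v (K + 1) / (K + 2 + α) := by
        rw [eq_div_iff h2.ne', h1]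
      have h6 : (1 + α) * (v K * ((K + 2 + α) / (K + 3 + 2 * α))) / (K + 2 + α)
          = v K * ((1 + α) / (K + 3 + 2 * α)) := by
        field_simp
      have h7 : ((K : ℝ) + 2 + α) / (K + 3 + 2 * α) = 1 - (1 + α) / (K + 3 + 2 * α) := by
        rw [eq_sub_iff_add_eq, ← add_div, div_eq_one_iff_eq h4.ne']
        ring
      rw [h5, h3, h6, h7]
      ring
  have hvlim : Tendsto v atTop (𝓝 0) := by
    have ha : 0 < 1 + α := by linarith
    have hc : 0 < 3 + 2 * α := by linarith
    have hub : ∀ K, v K ≤ Real.exp (-((1 + α) / (3 + 2 * α) *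
        ∑ i ∈ Finset.range K, 1 / ((i : ℝ) + 1))) := by
      intro K
      rw [Finset.mul_sum, ← Finset.sum_neg_distrib, Real.exp_sum]
      refine Finset.prod_le_prod (fun i _ => ?_) (fun i _ => ?_)
      · have := hpos3 i
        have : (0 : ℝ) ≤ i := Nat.cast_nonneg i
        apply div_nonneg <;> linarith
      · have h3 := hpos3 i
        have h0 : (0 : ℝ) ≤ i := Nat.cast_nonneg i
        refine le_trans ?_ (Real.add_one_le_exp _)
        have h6 : (1 + α) / (3 + 2 * α) * (1 / ((i : ℝ) + 1)) ≤ (1 + α) / (i + 3 + 2 * α) := by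
          rw [div_mul_div_comm, mul_one]
          apply div_le_div_of_nonneg_left ha.le h3
          nlinarith
        have h7 : ((i : ℝ) + 2 + α) / (i + 3 + 2 * α) = 1 - (1 + α) / (i + 3 + 2 * α) := by
          field_simp; ring
        linarith
    refine squeeze_zero (fun K => Finset.prod_nonneg fun i _ => ?_) hub ?_
    · have := hpos3 i
      have : (0 : ℝ) ≤ i := Nat.cast_nonneg i
      apply div_nonneg <;> linarith
    · refine Real.tendsto_exp_atBot.comp (tendsto_neg_atTop_atBot.comp ?_)
      exact Tendsto.const_mul_atTop (div_pos ha hc) Real.tendsto_sum_range_one_div_nat_succ_atTop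
  have hnn : ∀ l : ℝ, 0 < l → ∀ k : ℕ, 0 ≤ ∏ i ∈ Finset.range (k + 1),
      affine α (i + 1) / (l + affine α (i + 1)) := fun l hl k =>
    Finset.prod_nonneg fun i _ => div_nonneg (hf i).le (by linarith [hf i])
  have hpos : 0 < 2 + α := by linarith
  have hone : rhoHat (affine α) (2 + α) = 1 := by
    have hs : HasSum (fun k : ℕ => ∏ i ∈ Finset.range (k + 1),
        affine α (i + 1) / ((2 + α) + affine α (i + 1))) 1 := by
      rw [hasSum_iff_tendsto_nat_of_nonneg (hnn _ hpos)]
      simp only [hsum]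
      simpa using hvlim.const_sub 1
    rw [rhoHat, ← ENNReal.ofReal_tsum_of_nonneg (hnn _ hpos) hs.summable, hs.tsum_eq,
      ENNReal.ofReal_one]
  -- strict monotonicity in `λ`
  have hlt : ∀ l m : ℝ, 0 < l → l < m → rhoHat (affine α) m ≠ ⊤ →
      rhoHat (affine α) m < rhoHat (affine α) l := by
    intro l m hl hlm hfin
    have hterm : ∀ i : ℕ, affine α (i + 1) / (m + affine α (i + 1)) ≤
        affine α (i + 1) / (l + affine α (i + 1)) := fun i =>
      div_le_div_of_nonneg_left (hf i).le (by linarith [hf i]) (by linarith)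
    refine ENNReal.tsum_lt_tsum (i := 0) hfin (fun k => ENNReal.ofReal_le_ofReal
      (Finset.prod_le_prod (fun i _ => div_nonneg (hf i).le (by linarith [hf i]))
        fun i _ => hterm i)) ?_
    have h0 := hf 0
    rw [ENNReal.ofReal_lt_ofReal_iff]
    · simp only [zero_add, Finset.prod_range_one]
      simp only [zero_add] at h0
      exact div_lt_div_of_pos_left h0 (by linarith) (by linarith)
    · simp only [zero_add, Finset.prod_range_one]
      simp only [zero_add] at h0
      exact div_pos h0 (by linarith)
  constructor
  · rintro ⟨hl, h1⟩
    rcases lt_trichotomy lam (2 + α) with h | h | h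
    · have := hlt _ _ hl h (by simp [hone])
      simp [hone, h1] at this
    · exact h
    · have := hlt _ _ hpos h (by simp [h1])
      simp [hone, h1] at this
  · rintro rfl
    exact ⟨hpos, hone⟩

/-- For `f(k) = k + α` one has `p_1 = (2 + α) / (3 + 2α)`. -/
theorem limitDegree_affine_one {α : ℝ} (hα : -1 < α) :
    limitDegree (affine α) 1 = (2 + α) / (3 + 2 * α) := by
  have hm : malthusian (affine α) = 2 + α :=
    (rhoHat_affine_eq_one_iff hα _).1 (Classical.epsilon_spec
      (p := fun lam : ℝ => 0 < lam ∧ rhoHat (affine α) lam = 1)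
      ⟨2 + α, (rhoHat_affine_eq_one_iff hα _).2 rfl⟩)
  have h : 2 + α + (1 + α) = 3 + 2 * α := by ring
  simp [limitDegree, hm, affine, h]

/-! ### The random centering -/

/-- `γ = (1 + α) / (2 + α)`. -/
noncomputable def gam (α : ℝ) : ℝ := (1 + α) / (2 + α)

/-- `k_n = 1 - γ E[1{n - n^β ξ ≥ 1} / ⌊n - n^β ξ⌋]`. -/
noncomputable def contraction (α β : ℝ) (μ : Measure ℝ) (n : ℕ) : ℝ :=
  1 - gam α * ∫ x, {x : ℝ | 1 ≤ (n : ℝ) - (n : ℝ) ^ β * x}.indicator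
    (fun x => 1 / (infoTime β n x : ℝ)) x ∂μ

/-- `A_n = 1 + γ ∑_{i ≤ n, deg(i,n) = 1} E[1{1 ≤ n - n^β ξ < i} / ⌊n - n^β ξ⌋]
  - 1{deg(1,n) = 1} P(n - n^β ξ < 1)`. -/
noncomputable def drift (α β : ℝ) (μ : Measure ℝ) (p : ℕ → ℕ) (n : ℕ) : ℝ :=
  1 + gam α * (∑ i ∈ (Finset.Icc 1 n).filter (fun i => deg p i n = 1),
      ∫ x, {x : ℝ | 1 ≤ (n : ℝ) - (n : ℝ) ^ β * x ∧ (n : ℝ) - (n : ℝ) ^ β * x < (i : ℝ)}.indicator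
        (fun x => 1 / (infoTime β n x : ℝ)) x ∂μ)
    - (if deg p 1 n = 1 then μ.real {x : ℝ | (n : ℝ) - (n : ℝ) ^ β * x < 1} else 0)

/-- `𝔛_n = ∑_{i=1}^{n-1} (∏_{j=i+1}^{n-1} k_j) A_i`, i.e. `𝔛_1 = 0` and
`𝔛_{n+1} = k_n 𝔛_n + A_n` for `n ≥ 1`. -/
noncomputable def centering (α β : ℝ) (μ : Measure ℝ) (p : ℕ → ℕ) (n : ℕ) : ℝ :=
  ∑ i ∈ Finset.Ico 1 n, (∏ j ∈ Finset.Ico (i + 1) n, contraction α β μ j) * drift α β μ p i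

/-- The variance `(1 + α)(2 + α)² / ((3 + 2α)² (4 + 3α))` of the limit. -/
noncomputable def limitVariance (α : ℝ) : ℝ :=
  (1 + α) * (2 + α) ^ 2 / ((3 + 2 * α) ^ 2 * (4 + 3 * α))

/-! ### Real recursions -/

/-! The number `N` of leaves grows by `1 - L n`, where `L n` indicates that vertex `n + 1` attaches
to a leaf; let `q n` be its conditional probability given the tree at time `n`. Degrees never
decrease, so a leaf at time `n` was a leaf at every earlier time since its birth. A newcomer seeing
time `m` therefore hits a current leaf with probability `c(m) * (1 + α) / totalWeight α m`, where
`c(m)` counts the current leaves with label at most `m`, and the weight ratio is `γ / m` up to `O(1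
/ m ^ 2)`. Averaging over the delay makes the mean increment equal to `A_n - (1 - k_n) N`, up to
twice the expected reciprocal visible time (`IsParentSequence.abs_drift_error_le`).

Let `U` solve `U (n + 1) = k n * U n + (q n - L n)`. Then `N - 𝔛 - U` obeys a contracting recursion
forced only by these errors, which are `o(1 / √n)`, so it is `o(√n)` uniformly over trees
(`IsParentSequence.abs_remainder_le`). The first limit law thus reduces to one for `U`.

`CompensatedRecursion.tendstoInDistribution` proves the latter by characteristic functions: one step
replaces `φ(s)` by `φ(k n * s)` times nearly `exp (-s ^ 2 r (1 - r) / 2)`, provided `q n → r` in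
`L¹`. Since `n (1 - k n) → γ`, the accumulated variance is asymptotic to `n r (1 - r) / (1 + 2 γ)`.
Here `r = γ p₁`; the convergence of `q n` follows from `E|U n| ≤ √n` and `N = n p₁ + U + o(n)`.

The centering is compared with `n p₁`, which solves the undelayed recursion exactly; the deviation
is bounded by a sum of `delayError`, whatever the tree (`abs_centering_sub_le`). This sum is `o(n)`,
which gives the strong law. Under the stronger hypothesis it is `o(√n)`, which gives the second
limit law; the delicate term there is the truncation probability, controlled by comparing times `n`
and `2 n` (`truncProb_le`). -/

theorem isLittleO_of_abs_succ_le {Z d g : ℕ → ℝ} {n₀ : ℕ}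
    (hZ : ∀ n, n₀ ≤ n → |Z (n + 1)| ≤ |Z n| + d n) (hg : Monotone g)
    (hgt : Tendsto g atTop atTop) (hd : d =o[atTop] fun n => g (n + 1) - g n) :
    Z =o[atTop] g := by
  -- A discrete l'Hôpital rule: terms negligible against nonnegative increments with divergent sum
  -- have negligible partial sums, and the increments of `g` telescope.
  have hsum : (fun n => ∑ i ∈ Finset.range n, |d i|) =o[atTop] g := by
    have h1 := hd.norm_left.sum_range (fun n => sub_nonneg.2 (hg n.le_succ)) (by
      simp only [Finset.sum_range_sub]
      exact tendsto_atTop_add_const_right _ _ hgt)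
    simp only [Finset.sum_range_sub, Real.norm_eq_abs] at h1
    refine h1.trans_isBigO ((Asymptotics.isBigO_refl g atTop).sub ?_)
    exact (Asymptotics.isLittleO_const_left.2
      (Or.inr (tendsto_norm_atTop_atTop.comp hgt))).isBigO
  have hbound : ∀ n, n₀ ≤ n → |Z n| ≤ |Z n₀| + ∑ i ∈ Finset.range n, |d i| := by
    intro n hn
    induction n, hn using Nat.le_induction with
    | base => exact le_add_of_nonneg_right (Finset.sum_nonneg fun _ _ => abs_nonneg _)
    | succ n hn ih =>
      rw [Finset.sum_range_succ]
      linarith [hZ n hn, le_abs_self (d n)]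
  have hconst : (fun _ : ℕ => |Z n₀|) =o[atTop] g :=
    Asymptotics.isLittleO_const_left.2 (Or.inr (tendsto_norm_atTop_atTop.comp hgt))
  refine Asymptotics.IsBigO.trans_isLittleO ?_ (hconst.add hsum)
  refine Asymptotics.IsBigO.of_bound 1 ?_
  filter_upwards [eventually_ge_atTop n₀] with n hn
  rw [one_mul, Real.norm_eq_abs, Real.norm_eq_abs]
  exact (hbound n hn).trans (le_abs_self _)

theorem tendsto_div_of_abs_succ_le {Z d : ℕ → ℝ} {n₀ : ℕ}
    (hZ : ∀ n, n₀ ≤ n → |Z (n + 1)| ≤ |Z n| + d n) (hd : Tendsto d atTop (𝓝 0)) :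
    Tendsto (fun n : ℕ => Z n / (n : ℝ)) atTop (𝓝 0) := by
  refine (isLittleO_of_abs_succ_le hZ (g := fun n => (n : ℝ)) Nat.mono_cast
    tendsto_natCast_atTop_atTop ?_).tendsto_div_nhds_zero
  simpa [Asymptotics.isLittleO_one_iff] using hd

theorem tendsto_div_sqrt_of_abs_succ_le {Z d : ℕ → ℝ} {n₀ : ℕ}
    (hZ : ∀ n, n₀ ≤ n → |Z (n + 1)| ≤ |Z n| + d n)
    (hd : Tendsto (fun n : ℕ => √(n : ℝ) * d n) atTop (𝓝 0)) :
    Tendsto (fun n : ℕ => Z n / √(n : ℝ)) atTop (𝓝 0) := by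
  refine (isLittleO_of_abs_succ_le hZ (g := fun n : ℕ => √(n : ℝ))
    (fun a b h => Real.sqrt_le_sqrt (Nat.cast_le.2 h))
    (Real.tendsto_sqrt_atTop.comp tendsto_natCast_atTop_atTop) ?_).tendsto_div_nhds_zero
  rw [Asymptotics.isLittleO_iff]
  intro c hc
  have h1 := (Metric.tendsto_atTop.1 hd) (c / 4) (by positivity)
  obtain ⟨N, hN⟩ := h1
  filter_upwards [eventually_ge_atTop (max N 1)] with n hn
  have hn1 : (1 : ℝ) ≤ n := by exact_mod_cast (le_max_right N 1).trans hn
  have h2 := (hN n ((le_max_left N 1).trans hn)).le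
  rw [Real.dist_eq, sub_zero, abs_mul, abs_of_nonneg (Real.sqrt_nonneg _)] at h2
  push_cast
  set a := √(n : ℝ)
  set b := √((n : ℝ) + 1)
  have ha : 1 ≤ a := Real.one_le_sqrt.2 hn1
  have hab : a ≤ b := Real.sqrt_le_sqrt (by linarith)
  have ha2 : a * a = n := Real.mul_self_sqrt (by linarith)
  have hb2 : b * b = n + 1 := Real.mul_self_sqrt (by linarith)
  -- From `(b - a) * (b + a) = 1` and `b + a ≤ 3 * a`, the increment `b - a` of the square root is
  -- at least `1 / (3 * a)`; the tolerance `c / 4` lies below the resulting `c / 3`.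
  have hb : b ≤ 2 * a := by nlinarith
  rw [Real.norm_eq_abs, Real.norm_eq_abs, abs_of_nonneg (sub_nonneg.2 hab)]
  have h3 : 1 ≤ 3 * a * (b - a) := by nlinarith
  have h4 : a * |d n| ≤ a * (c * (b - a)) := by
    nlinarith [mul_le_mul_of_nonneg_left h3 hc.le]
  exact le_of_mul_le_mul_left h4 (by linarith)

/-- If `n (1 - k n) → a` and `b n → b`, then `x (n + 1) = k n * x n + b n` grows like
`b / (1 + a) * n`. -/
theorem tendsto_div_of_linear_recursion {x k b : ℕ → ℝ} {a c : ℝ} {n₀ : ℕ} (ha : 0 ≤ a)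
    (hx : ∀ n, n₀ ≤ n → x (n + 1) = k n * x n + b n) (hk0 : ∀ n, 0 ≤ k n) (hk1 : ∀ n, k n ≤ 1)
    (hk : Tendsto (fun n : ℕ => (n : ℝ) * (1 - k n)) atTop (𝓝 a)) (hb : Tendsto b atTop (𝓝 c)) :
    Tendsto (fun n : ℕ => x n / (n : ℝ)) atTop (𝓝 (c / (1 + a))) := by
  have h1a : 1 + a ≠ 0 := by positivity
  set l := c / (1 + a) with hl
  have hlc : l + a * l = c := by rw [hl]; field_simp
  -- The slope `l` is chosen so that `x n - n * l` satisfies the same contracting recursion with a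
  -- forcing that vanishes in the limit.
  have hd : Tendsto (fun n : ℕ => |b n - l - (n * (1 - k n)) * l|) atTop (𝓝 0) := by
    have := ((hb.sub_const l).sub (hk.mul_const l)).abs
    rwa [show c - l - a * l = 0 by linarith, abs_zero] at this
  have h := tendsto_div_of_abs_succ_le (Z := fun n => x n - n * l) (n₀ := n₀) (fun n hn => ?_) hd
  · have h2 := h.add_const l
    rw [zero_add] at h2
    refine h2.congr' ?_
    filter_upwards [eventually_ge_atTop 1] with n hn
    have : (n : ℝ) ≠ 0 := by positivity
    field_simp
    ring
  · have : x (n + 1) - ((n + 1 : ℕ) : ℝ) * l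
        = k n * (x n - n * l) + (b n - l - (n * (1 - k n)) * l) := by
      rw [hx n hn]; push_cast; ring
    rw [this]
    refine (abs_add_le _ _).trans (add_le_add_left ?_ _)
    rw [abs_mul, abs_of_nonneg (hk0 n)]
    exact mul_le_of_le_one_left (abs_nonneg _) (hk1 n)

/-! ### A central limit theorem for contracted sums of compensated indicators -/

/-- The indicators `L n` have the conditional probabilities `q n` given the past `ℱ n`, and `U` is
obtained by contracting with the factors `k n` and adding the compensated indicators. -/
structure CompensatedRecursion {Ω : Type*} [mΩ : MeasurableSpace Ω] (P : Measure Ω)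
    (ℱ : ℕ → MeasurableSpace Ω) (k : ℕ → ℝ) (q L U : ℕ → Ω → ℝ) : Prop where
  le : ∀ n, ℱ n ≤ mΩ
  k_nonneg : ∀ n, 0 ≤ k n
  k_le_one : ∀ n, k n ≤ 1
  q_nonneg : ∀ n ω, 0 ≤ q n ω
  q_le_one : ∀ n ω, q n ω ≤ 1
  L_mem : ∀ n ω, L n ω = 0 ∨ L n ω = 1
  U_zero : ∀ ω, U 0 ω = 0
  U_succ : ∀ n ω, U (n + 1) ω = k n * U n ω + (q n ω - L n ω)
  measurable_U : ∀ n, Measurable[ℱ n] (U n)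
  measurable_q : ∀ n, Measurable[ℱ n] (q n)
  measurable_L : ∀ n, Measurable (L n)
  cond : ∀ n (g : Ω → ℝ), Measurable[ℱ n] g → (∃ C, ∀ ω, |g ω| ≤ C) →
    ∫ ω, g ω * L n ω ∂P = ∫ ω, g ω * q n ω ∂P

theorem integrable_of_measurable_of_norm_le {Ω E : Type*} [MeasurableSpace Ω] {P : Measure Ω}
    [IsFiniteMeasure P] [NormedAddCommGroup E] [MeasurableSpace E] [BorelSpace E]
    [SecondCountableTopology E] {f : Ω → E} (hf : Measurable f) {C : ℝ} (hC : ∀ ω, ‖f ω‖ ≤ C) :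
    Integrable f P :=
  Integrable.of_bound hf.aestronglyMeasurable C (ae_of_all _ hC)

/-- The characteristic function of a centred Bernoulli variable at a small argument. -/
theorem norm_compensated_bernoulli_charFun_sub_le {s q : ℝ} (hs : |s| ≤ 1) (hq0 : 0 ≤ q)
    (hq1 : q ≤ 1) :
    ‖Complex.exp ((s * q : ℝ) * Complex.I) * (1 + q * (Complex.exp ((-s : ℝ) * Complex.I) - 1))
      - ((1 - s ^ 2 * (q * (1 - q)) / 2 : ℝ) : ℂ)‖ ≤ |s| ^ 3 := by
  have taylor : ∀ x : ℝ, |x| ≤ |s| →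
      ‖Complex.exp (x * Complex.I) - (1 + x * Complex.I - x ^ 2 / 2)‖ ≤ |s| ^ 3 := by
    intro x hx
    have h1 : ‖(x : ℂ) * Complex.I‖ = |x| := by simp
    have h2 := Complex.exp_bound (x := x * Complex.I) (by rw [h1]; linarith) (n := 3) (by norm_num)
    rw [h1] at h2
    have h3 : ∑ m ∈ Finset.range 3, ((x : ℂ) * Complex.I) ^ m / (m.factorial : ℂ)
        = 1 + x * Complex.I - x ^ 2 / 2 := by
      simp [Finset.sum_range_succ, mul_pow, Nat.factorial]
      ring
    rw [h3] at h2
    refine h2.trans ?_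
    have h4 : |x| ^ 3 ≤ |s| ^ 3 := pow_le_pow_left₀ (abs_nonneg _) hx 3
    have h5 : 0 ≤ |x| ^ 3 := by positivity
    norm_num [Nat.factorial]
    linarith
  have h1 := taylor (s * q) (by
    rw [abs_mul, abs_of_nonneg hq0]; exact mul_le_of_le_one_right (abs_nonneg _) hq1)
  have h2 := taylor (s * q + -s) (by
    rw [show s * q + -s = -(s * (1 - q)) by ring, abs_neg, abs_mul,
      abs_of_nonneg (sub_nonneg.2 hq1)]
    exact mul_le_of_le_one_right (abs_nonneg _) (by linarith))
  have h3 : Complex.exp ((s * q + -s : ℝ) * Complex.I)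
      = Complex.exp ((s * q : ℝ) * Complex.I) * Complex.exp ((-s : ℝ) * Complex.I) := by
    rw [← Complex.exp_add]; push_cast; ring_nf
  set A := Complex.exp ((s * q : ℝ) * Complex.I)
  set B := Complex.exp ((s * q + -s : ℝ) * Complex.I)
  -- The centred variable takes the value `q` with probability `1 - q` and `q - 1` with probability
  -- `q`; in this mixture of second-order Taylor polynomials the linear terms cancel.
  have h4 : A * (1 + q * (Complex.exp ((-s : ℝ) * Complex.I) - 1))
      - ((1 - s ^ 2 * (q * (1 - q)) / 2 : ℝ) : ℂ)
      = ((1 - q : ℝ) : ℂ) * (A - (1 + (s * q : ℝ) * Complex.I - (s * q : ℝ) ^ 2 / 2))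
        + (q : ℂ) * (B - (1 + (s * q + -s : ℝ) * Complex.I - (s * q + -s : ℝ) ^ 2 / 2)) := by
    rw [h3]; push_cast; ring
  rw [h4]
  refine (norm_add_le _ _).trans ?_
  rw [norm_mul, norm_mul, Complex.norm_real, Complex.norm_real, Real.norm_eq_abs,
    Real.norm_eq_abs, abs_of_nonneg hq0, abs_of_nonneg (sub_nonneg.2 hq1)]
  nlinarith

/-- Trading the random `q` for a constant `r` lets the Gaussian factor leave the expectation. Two
errors add to the Taylor error: the variance changes by `|r - q| * |1 - r - q| ≤ |q - r|`, and
linearising the exponential costs at most `s ^ 4 ≤ |s| ^ 3`. -/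
theorem norm_compensated_bernoulli_charFun_sub_exp_le {s q r : ℝ} (hs : |s| ≤ 1) (hq0 : 0 ≤ q)
    (hq1 : q ≤ 1) (hr0 : 0 ≤ r) (hr1 : r ≤ 1) :
    ‖Complex.exp ((s * q : ℝ) * Complex.I) * (1 + q * (Complex.exp ((-s : ℝ) * Complex.I) - 1))
      - (Real.exp (-(s ^ 2 * (r * (1 - r)) / 2)) : ℂ)‖ ≤ s ^ 2 * |q - r| + 2 * |s| ^ 3 := by
  have h1 := norm_compensated_bernoulli_charFun_sub_le hs hq0 hq1
  have hs2 : s ^ 2 ≤ 1 := by rw [← sq_abs]; nlinarith [abs_nonneg s]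
  have hrr : r * (1 - r) ≤ 1 := by nlinarith
  have hrr0 : 0 ≤ r * (1 - r) := by nlinarith
  have hy0 : 0 ≤ s ^ 2 * (r * (1 - r)) / 2 := by positivity
  have hy1 : s ^ 2 * (r * (1 - r)) / 2 ≤ s ^ 2 := by nlinarith [sq_nonneg s]
  have h2 := Real.abs_exp_sub_one_sub_id_le (x := -(s ^ 2 * (r * (1 - r)) / 2)) (by
    rw [abs_neg, abs_of_nonneg hy0]; linarith)
  have h3 : (-(s ^ 2 * (r * (1 - r)) / 2)) ^ 2 ≤ |s| ^ 3 := by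
    have h4 : (s ^ 2 * (r * (1 - r)) / 2) ^ 2 ≤ (s ^ 2) ^ 2 := pow_le_pow_left₀ hy0 hy1 2
    have h5 : (s ^ 2) ^ 2 ≤ |s| ^ 3 := by
      rw [← sq_abs s]
      calc (|s| ^ 2) ^ 2 = |s| ^ 3 * |s| := by ring
        _ ≤ |s| ^ 3 := mul_le_of_le_one_right (by positivity) hs
    rw [neg_sq]
    exact h4.trans h5
  have h6 : |(1 - s ^ 2 * (q * (1 - q)) / 2) - Real.exp (-(s ^ 2 * (r * (1 - r)) / 2))|
      ≤ s ^ 2 * |q - r| + |s| ^ 3 := by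
    have h7 : (1 - s ^ 2 * (q * (1 - q)) / 2) - Real.exp (-(s ^ 2 * (r * (1 - r)) / 2))
        = s ^ 2 / 2 * ((r - q) * (1 - r - q))
          - (Real.exp (-(s ^ 2 * (r * (1 - r)) / 2)) - 1 - -(s ^ 2 * (r * (1 - r)) / 2)) := by ring
    rw [h7]
    refine (abs_sub _ _).trans (add_le_add ?_ (h2.trans h3))
    rw [abs_mul, abs_mul, abs_of_nonneg (by positivity : 0 ≤ s ^ 2 / 2), abs_sub_comm r q]
    have h8 : |1 - r - q| ≤ 1 := abs_le.2 ⟨by linarith, by linarith⟩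
    nlinarith [mul_le_of_le_one_right (abs_nonneg (q - r)) h8, abs_nonneg (q - r), sq_nonneg s,
      mul_nonneg (sq_nonneg s) (abs_nonneg (q - r)),
      mul_le_mul_of_nonneg_left (mul_le_of_le_one_right (abs_nonneg (q - r)) h8) (sq_nonneg s)]
  calc _ ≤ _ := norm_sub_le_norm_sub_add_norm_sub _
        ((1 - s ^ 2 * (q * (1 - q)) / 2 : ℝ) : ℂ) _
    _ ≤ |s| ^ 3 + (s ^ 2 * |q - r| + |s| ^ 3) := by
        refine add_le_add h1 ?_
        rw [← Complex.ofReal_sub, Complex.norm_real]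
        exact h6
    _ = _ := by ring

namespace CompensatedRecursion

variable {Ω : Type*} [mΩ : MeasurableSpace Ω] {P : Measure Ω}
  {ℱ : ℕ → MeasurableSpace Ω} {k : ℕ → ℝ} {q L U : ℕ → Ω → ℝ}

theorem measurable_U' (h : CompensatedRecursion P ℱ k q L U) (n : ℕ) : Measurable (U n) :=
  (h.measurable_U n).mono (h.le n) le_rfl

theorem measurable_q' (h : CompensatedRecursion P ℱ k q L U) (n : ℕ) : Measurable (q n) :=
  (h.measurable_q n).mono (h.le n) le_rfl

theorem abs_sub_le_one (h : CompensatedRecursion P ℱ k q L U) (n : ℕ) (ω : Ω) :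
    |q n ω - L n ω| ≤ 1 := by
  have h0 := h.q_nonneg n ω
  have h1 := h.q_le_one n ω
  rcases h.L_mem n ω with hL | hL <;> rw [hL, abs_le] <;> constructor <;> linarith

theorem abs_U_le (h : CompensatedRecursion P ℱ k q L U) (n : ℕ) (ω : Ω) : |U n ω| ≤ n := by
  induction n with
  | zero => simp [h.U_zero]
  | succ n ih =>
    rw [h.U_succ]
    refine (abs_add_le _ _).trans ?_
    rw [abs_mul, abs_of_nonneg (h.k_nonneg n)]
    push_cast
    exact add_le_add ((mul_le_of_le_one_left (abs_nonneg _) (h.k_le_one n)).trans ih)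
      (h.abs_sub_le_one n ω)

variable [IsProbabilityMeasure P]

/-- Martingale orthogonality: the cross term vanishes by `cond` applied to `U n`, the factor `k n`
only shrinks, and each compensated indicator contributes at most `1`. -/
theorem integral_sq_le (h : CompensatedRecursion P ℱ k q L U) (n : ℕ) :
    ∫ ω, U n ω ^ 2 ∂P ≤ n := by
  induction n with
  | zero => simp [h.U_zero]
  | succ n ih =>
    have hU := h.measurable_U' n
    have hq := h.measurable_q' n
    have hL := h.measurable_L n
    have hLb : ∀ ω, |L n ω| ≤ 1 := fun ω => by rcases h.L_mem n ω with h | h <;> simp [h]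
    have hqb : ∀ ω, |q n ω| ≤ 1 := fun ω => by
      rw [abs_of_nonneg (h.q_nonneg n ω)]; exact h.q_le_one n ω
    have hUb := h.abs_U_le n
    have hc := h.cond n (U n) (h.measurable_U n) ⟨n, hUb⟩
    have i1 : Integrable (fun ω => U n ω * L n ω) P :=
      integrable_of_measurable_of_norm_le (hU.mul hL) (C := n) fun ω => by
        rw [Real.norm_eq_abs, abs_mul]
        exact (mul_le_of_le_one_right (abs_nonneg _) (hLb ω)).trans (hUb ω)
    have i2 : Integrable (fun ω => U n ω * q n ω) P :=
      integrable_of_measurable_of_norm_le (hU.mul hq) (C := n) fun ω => by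
        rw [Real.norm_eq_abs, abs_mul]
        exact (mul_le_of_le_one_right (abs_nonneg _) (hqb ω)).trans (hUb ω)
    have i3 : Integrable (fun ω => U n ω ^ 2) P :=
      integrable_of_measurable_of_norm_le (hU.pow_const 2) (C := (n : ℝ) ^ 2) fun ω => by
        rw [Real.norm_eq_abs, abs_pow]
        exact pow_le_pow_left₀ (abs_nonneg _) (hUb ω) 2
    have i4 : Integrable (fun ω => (q n ω - L n ω) ^ 2) P :=
      integrable_of_measurable_of_norm_le ((hq.sub hL).pow_const 2) (C := 1) fun ω => by
        rw [Real.norm_eq_abs, abs_pow]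
        exact pow_le_one₀ (abs_nonneg _) (h.abs_sub_le_one n ω)
    have e : ∀ ω, U (n + 1) ω ^ 2 = (k n) ^ 2 * U n ω ^ 2
        + (2 * k n * (U n ω * q n ω - U n ω * L n ω) + (q n ω - L n ω) ^ 2) := by
      intro ω; rw [h.U_succ]; ring
    simp_rw [e]
    have i5 : Integrable (fun ω => 2 * k n * (U n ω * q n ω - U n ω * L n ω)) P :=
      (i2.sub i1).const_mul _
    have i6 : Integrable (fun ω => 2 * k n * (U n ω * q n ω - U n ω * L n ω)
        + (q n ω - L n ω) ^ 2) P := i5.add i4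
    rw [integral_add (i3.const_mul _) i6, integral_add i5 i4, integral_const_mul,
      integral_const_mul, integral_sub i2 i1, hc, sub_self, mul_zero, zero_add]
    have h4 : ∫ ω, (q n ω - L n ω) ^ 2 ∂P ≤ 1 := by
      calc _ ≤ ∫ _, (1 : ℝ) ∂P := integral_mono i4 (integrable_const _) fun ω => by
            simpa using pow_le_one₀ (abs_nonneg _) (h.abs_sub_le_one n ω) (n := 2)
        _ = 1 := by simp
    have h5 : k n ^ 2 * ∫ ω, U n ω ^ 2 ∂P ≤ ∫ ω, U n ω ^ 2 ∂P :=
      mul_le_of_le_one_left (integral_nonneg fun _ => sq_nonneg _)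
        (pow_le_one₀ (h.k_nonneg n) (h.k_le_one n))
    push_cast
    linarith

/-- Cauchy–Schwarz, obtained from the nonnegativity of the variance of `|U n|`. -/
theorem integral_abs_le (h : CompensatedRecursion P ℱ k q L U) (n : ℕ) :
    ∫ ω, |U n ω| ∂P ≤ √(n : ℝ) := by
  have hU := h.measurable_U' n
  have i1 : Integrable (fun ω => |U n ω|) P :=
    integrable_of_measurable_of_norm_le hU.abs (C := n) fun ω => by
      rw [Real.norm_eq_abs, abs_abs]; exact h.abs_U_le n ω
  have i3 : Integrable (fun ω => U n ω ^ 2) P :=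
    integrable_of_measurable_of_norm_le (hU.pow_const 2) (C := (n : ℝ) ^ 2) fun ω => by
      rw [Real.norm_eq_abs, abs_pow]
      exact pow_le_pow_left₀ (abs_nonneg _) (h.abs_U_le n ω) 2
  set m := ∫ ω, |U n ω| ∂P with hm
  have h0 : 0 ≤ ∫ ω, (|U n ω| - m) ^ 2 ∂P := integral_nonneg fun _ => sq_nonneg _
  have e : ∀ ω, (|U n ω| - m) ^ 2 = U n ω ^ 2 - (2 * m * |U n ω| - m ^ 2) := fun ω => by
    rw [sub_sq, sq_abs]; ring
  simp_rw [e] at h0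
  have i5 : Integrable (fun ω => 2 * m * |U n ω| - m ^ 2) P :=
    (i1.const_mul _).sub (integrable_const _)
  rw [integral_sub i3 i5, integral_sub (i1.const_mul _) (integrable_const _), integral_const_mul,
    ← hm] at h0
  simp only [integral_const, probReal_univ, one_smul] at h0
  refine Real.le_sqrt_of_sq_le ?_
  nlinarith [h.integral_sq_le n]

theorem complex_cond (h : CompensatedRecursion P ℱ k q L U) (n : ℕ) {g : Ω → ℂ}
    (hg : Measurable[ℱ n] g) (hb : ∀ ω, ‖g ω‖ ≤ 1) :
    ∫ ω, g ω * L n ω ∂P = ∫ ω, g ω * q n ω ∂P := by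
  have hg' : Measurable g := hg.mono (h.le n) le_rfl
  have hre := h.cond n (fun ω => (g ω).re) (Complex.measurable_re.comp hg)
    ⟨1, fun ω => (Complex.abs_re_le_norm _).trans (hb ω)⟩
  have him := h.cond n (fun ω => (g ω).im) (Complex.measurable_im.comp hg)
    ⟨1, fun ω => (Complex.abs_im_le_norm _).trans (hb ω)⟩
  have hint : ∀ f : Ω → ℝ, Measurable f → (∀ ω, |f ω| ≤ 1) →
      Integrable (fun ω => g ω * (f ω : ℂ)) P := fun f hf hfb =>
    integrable_of_measurable_of_norm_le (hg'.mul (Complex.measurable_ofReal.comp hf)) (C := 1)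
      fun ω => by
        rw [norm_mul, Complex.norm_real]
        exact mul_le_one₀ (hb ω) (norm_nonneg _) (hfb ω)
  have iL := hint (L n) (h.measurable_L n) fun ω => by rcases h.L_mem n ω with h | h <;> simp [h]
  have iq := hint (q n) (h.measurable_q' n) fun ω => by
    rw [abs_of_nonneg (h.q_nonneg n ω)]; exact h.q_le_one n ω
  apply Complex.ext
  · have e1 := integral_re (𝕜 := ℂ) iL
    have e2 := integral_re (𝕜 := ℂ) iq
    simp only [RCLike.re_eq_complex_re, Complex.re_mul_ofReal] at e1 e2
    rw [← e1, ← e2, hre]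
  · have e1 := integral_im (𝕜 := ℂ) iL
    have e2 := integral_im (𝕜 := ℂ) iq
    simp only [RCLike.im_eq_complex_im, Complex.im_mul_ofReal] at e1 e2
    rw [← e1, ← e2, him]

/-- Since `L n` is an indicator, `exp (-i s L)` is affine in it, so conditioning replaces `L n` by
`q n`. What remains next to `exp (i k s U)` is the characteristic function of a centred Bernoulli
variable, which is close to a constant Gaussian factor. -/
theorem charFun_step (h : CompensatedRecursion P ℱ k q L U) (n : ℕ) {s r : ℝ} (hs : |s| ≤ 1)
    (hr0 : 0 ≤ r) (hr1 : r ≤ 1) :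
    ‖∫ ω, Complex.exp ((s * U (n + 1) ω : ℝ) * Complex.I) ∂P
      - (∫ ω, Complex.exp ((k n * s * U n ω : ℝ) * Complex.I) ∂P)
        * (Real.exp (-(s ^ 2 * (r * (1 - r)) / 2)) : ℂ)‖
      ≤ s ^ 2 * ∫ ω, |q n ω - r| ∂P + 2 * |s| ^ 3 := by
  have hU := h.measurable_U' n
  have hq := h.measurable_q' n
  have hL := h.measurable_L n
  set c : ℂ := Complex.exp ((-s : ℝ) * Complex.I) - 1
  set a : Ω → ℂ := fun ω => Complex.exp ((k n * s * U n ω : ℝ) * Complex.I)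
  set b : Ω → ℂ := fun ω => Complex.exp ((s * q n ω : ℝ) * Complex.I)
  have ha : Measurable[ℱ n] a :=
    Complex.measurable_exp.comp ((Complex.measurable_ofReal.comp
      ((h.measurable_U n).const_mul _)).mul_const _)
  have hb : Measurable[ℱ n] b :=
    Complex.measurable_exp.comp ((Complex.measurable_ofReal.comp
      ((h.measurable_q n).const_mul _)).mul_const _)
  have ha' : Measurable a := ha.mono (h.le n) le_rfl
  have hb' : Measurable b := hb.mono (h.le n) le_rfl
  have na : ∀ ω, ‖a ω‖ = 1 := fun ω => Complex.norm_exp_ofReal_mul_I _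
  have nb : ∀ ω, ‖b ω‖ = 1 := fun ω => Complex.norm_exp_ofReal_mul_I _
  have hab1 : ∀ ω, ‖a ω * b ω‖ ≤ 1 := fun ω => by rw [norm_mul, na, nb, one_mul]
  have e1 : ∀ ω, Complex.exp ((s * U (n + 1) ω : ℝ) * Complex.I)
      = a ω * b ω + c * (a ω * b ω * (L n ω : ℂ)) := by
    intro ω
    have h1 : Complex.exp ((s * U (n + 1) ω : ℝ) * Complex.I)
        = a ω * b ω * Complex.exp ((-(s * L n ω) : ℝ) * Complex.I) := by
      simp only [a, b]
      rw [← Complex.exp_add, ← Complex.exp_add, h.U_succ]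
      push_cast; ring_nf
    rw [h1]
    rcases h.L_mem n ω with h0 | h0
    · simp [h0]
    · simp only [h0, c]; push_cast; ring_nf
  have i0 : Integrable (fun ω => a ω * b ω) P :=
    integrable_of_measurable_of_norm_le (ha'.mul hb') hab1
  have hint : ∀ f : Ω → ℝ, Measurable f → (∀ ω, |f ω| ≤ 1) →
      Integrable (fun ω => a ω * b ω * (f ω : ℂ)) P := fun f hf hfb =>
    integrable_of_measurable_of_norm_le ((ha'.mul hb').mul (Complex.measurable_ofReal.comp hf))
      (C := 1) fun ω => by
        rw [norm_mul, Complex.norm_real]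
        exact mul_le_one₀ (hab1 ω) (norm_nonneg _) (hfb ω)
  have iL := hint (L n) hL fun ω => by rcases h.L_mem n ω with h | h <;> simp [h]
  have iq := hint (q n) hq fun ω => by
    rw [abs_of_nonneg (h.q_nonneg n ω)]; exact h.q_le_one n ω
  have ia : Integrable a P := integrable_of_measurable_of_norm_le ha' fun ω => (na ω).le
  have e2 : ∫ ω, Complex.exp ((s * U (n + 1) ω : ℝ) * Complex.I) ∂P
      = ∫ ω, a ω * (b ω * (1 + q n ω * c)) ∂P := by
    simp_rw [e1]
    rw [integral_add i0 (iL.const_mul c), integral_const_mul,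
      h.complex_cond n (g := fun ω => a ω * b ω) (ha.mul hb) hab1, ← integral_const_mul,
      ← integral_add i0 (iq.const_mul c)]
    congr 1; ext ω; ring
  have i2 : Integrable (fun ω => a ω * (b ω * (1 + q n ω * c))) P := by
    refine (i0.add (iq.const_mul c)).congr (ae_of_all _ fun ω => ?_)
    simp only [Pi.add_apply]; ring
  rw [e2, ← integral_mul_const, ← integral_sub i2 (ia.mul_const _)]
  refine (norm_integral_le_integral_norm _).trans ?_
  have i3 : Integrable (fun ω => |q n ω - r|) P :=
    integrable_of_measurable_of_norm_le (hq.sub_const r).abs (C := 1) fun ω => by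
      rw [Real.norm_eq_abs, abs_abs, abs_le]
      constructor <;> linarith [h.q_nonneg n ω, h.q_le_one n ω]
  calc _ ≤ ∫ ω, (s ^ 2 * |q n ω - r| + 2 * |s| ^ 3) ∂P := by
        refine integral_mono (i2.sub (ia.mul_const _)).norm
          ((i3.const_mul _).add (integrable_const _)) fun ω => ?_
        dsimp only
        rw [← mul_sub, norm_mul, na, one_mul]
        exact norm_compensated_bernoulli_charFun_sub_exp_le hs (h.q_nonneg n ω) (h.q_le_one n ω)
          hr0 hr1
    _ = _ := by
        rw [integral_add (i3.const_mul _) (integrable_const _), integral_const_mul]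
        simp

/-- Iterating the one-step estimate moves the argument from `s` to `k n * s`, so the induction must
run over all small `s`. Contraction keeps the argument small, so errors only add, and the exponents
combine through the recursion for `S`. -/
theorem norm_charFun_sub_le (h : CompensatedRecursion P ℱ k q L U) {r : ℝ} (hr0 : 0 ≤ r)
    (hr1 : r ≤ 1) {S : ℕ → ℝ} (hS0 : S 0 = 0) (hS : ∀ n, S (n + 1) = k n ^ 2 * S n + 1) (n : ℕ)
    {s : ℝ} (hs : |s| ≤ 1) :
    ‖∫ ω, Complex.exp ((s * U n ω : ℝ) * Complex.I) ∂P
      - (Real.exp (-(s ^ 2 * (r * (1 - r)) * S n / 2)) : ℂ)‖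
      ≤ s ^ 2 * ∑ i ∈ Finset.range n, ∫ ω, |q i ω - r| ∂P + 2 * n * |s| ^ 3 := by
  induction n generalizing s with
  | zero => simp [h.U_zero, hS0]
  | succ n ih =>
    have hk0 := h.k_nonneg n
    have hks : |k n * s| ≤ |s| := by
      rw [abs_mul, abs_of_nonneg hk0]
      exact mul_le_of_le_one_left (abs_nonneg _) (h.k_le_one n)
    have h1 := h.charFun_step n hs hr0 hr1
    have h2 := ih (hks.trans hs)
    set E : ℝ := Real.exp (-(s ^ 2 * (r * (1 - r)) / 2))
    have hE : ‖(E : ℂ)‖ ≤ 1 := by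
      rw [Complex.norm_real, Real.norm_eq_abs, Real.abs_exp, Real.exp_le_one_iff]
      have : 0 ≤ r * (1 - r) := by nlinarith
      have := mul_nonneg (sq_nonneg s) this
      linarith
    have e : (Real.exp (-(s ^ 2 * (r * (1 - r)) * S (n + 1) / 2)) : ℂ)
        = (Real.exp (-((k n * s) ^ 2 * (r * (1 - r)) * S n / 2)) : ℂ) * (E : ℂ) := by
      rw [← Complex.ofReal_mul, ← Real.exp_add, hS]
      ring_nf
    have hsq : (k n * s) ^ 2 ≤ s ^ 2 := sq_le_sq.2 hks
    have hcu : |k n * s| ^ 3 ≤ |s| ^ 3 := pow_le_pow_left₀ (abs_nonneg _) hks 3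
    have hsum : 0 ≤ ∑ i ∈ Finset.range n, ∫ ω, |q i ω - r| ∂P :=
      Finset.sum_nonneg fun i _ => integral_nonneg fun _ => abs_nonneg _
    calc _ ≤ _ := norm_sub_le_norm_sub_add_norm_sub _
          ((∫ ω, Complex.exp ((k n * s * U n ω : ℝ) * Complex.I) ∂P) * (E : ℂ)) _
      _ ≤ (s ^ 2 * ∫ ω, |q n ω - r| ∂P + 2 * |s| ^ 3) +
          (s ^ 2 * ∑ i ∈ Finset.range n, ∫ ω, |q i ω - r| ∂P + 2 * n * |s| ^ 3) := by
          refine add_le_add h1 ?_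
          rw [e, ← sub_mul, norm_mul]
          refine (mul_le_of_le_one_right (norm_nonneg _) hE).trans (h2.trans ?_)
          gcongr
      _ = _ := by
          rw [Finset.sum_range_succ]; push_cast; ring

/-- The central limit theorem for `U`. -/
theorem tendstoInDistribution (h : CompensatedRecursion P ℱ k q L U) {a r : ℝ} (ha : 0 ≤ a)
    (hk : Tendsto (fun n : ℕ => (n : ℝ) * (1 - k n)) atTop (𝓝 a)) (hr0 : 0 ≤ r) (hr1 : r ≤ 1)
    (hq : Tendsto (fun n => ∫ ω, |q n ω - r| ∂P) atTop (𝓝 0)) :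
    TendstoInDistribution (fun (n : ℕ) ω => U n ω / √(n : ℝ)) atTop (fun x : ℝ => x) (fun _ => P)
      (gaussianReal 0 (r * (1 - r) / (1 + 2 * a)).toNNReal) := by
  refine ⟨fun n => ((h.measurable_U' n).div_const _).aemeasurable, aemeasurable_id, ?_⟩
  refine ProbabilityMeasure.tendsto_of_tendsto_charFun fun t => ?_
  have hrr : 0 ≤ r * (1 - r) := by nlinarith
  let S : ℕ → ℝ := fun n => Nat.rec 0 (fun m x => k m ^ 2 * x + 1) n
  have hS : ∀ n, S (n + 1) = k n ^ 2 * S n + 1 := fun n => rfl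
  have hk1 : Tendsto k atTop (𝓝 1) := by
    have h1 := hk.mul (tendsto_inv_atTop_nhds_zero_nat (𝕜 := ℝ))
    rw [mul_zero] at h1
    have h2 := h1.const_sub 1
    rw [sub_zero] at h2
    refine h2.congr' ?_
    filter_upwards [eventually_ge_atTop 1] with n hn
    have : (n : ℝ) ≠ 0 := by positivity
    field_simp
    ring
  -- The factor is now `k n ^ 2`, and `n * (1 - k n ^ 2) = n * (1 - k n) * (1 + k n)` tends to `2 *
  -- a`.
  have hSlim : Tendsto (fun n : ℕ => S n / (n : ℝ)) atTop (𝓝 (1 / (1 + 2 * a))) := by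
    refine tendsto_div_of_linear_recursion (k := fun n => k n ^ 2) (b := fun _ => 1) (n₀ := 0)
      (by positivity) (fun n _ => hS n) (fun n => sq_nonneg _)
      (fun n => pow_le_one₀ (h.k_nonneg n) (h.k_le_one n)) ?_ tendsto_const_nhds
    have := hk.mul (hk1.const_add 1)
    rw [show a * (1 + 1) = 2 * a by ring] at this
    refine this.congr fun n => ?_
    ring
  have hCes : Tendsto (fun n : ℕ => (∑ i ∈ Finset.range n, ∫ ω, |q i ω - r| ∂P) / (n : ℝ)) atTop
      (𝓝 0) := by
    simpa [div_eq_inv_mul] using hq.cesaro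
  simp only [ProbabilityMeasure.coe_mk, Measure.map_id']
  rw [charFun_gaussianReal]
  have hE : Tendsto (fun n : ℕ =>
      (Real.exp (-((t / √(n : ℝ)) ^ 2 * (r * (1 - r)) * S n / 2)) : ℂ)) atTop
      (𝓝 (Complex.exp (t * (0 : ℝ) * Complex.I
        - ((r * (1 - r) / (1 + 2 * a)).toNNReal : ℝ) * t ^ 2 / 2))) := by
    rw [Real.coe_toNNReal _ (by positivity)]
    have h1 : Tendsto (fun n : ℕ => -(t ^ 2 * (r * (1 - r)) * (S n / (n : ℝ)) / 2)) atTop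
        (𝓝 (-(t ^ 2 * (r * (1 - r)) * (1 / (1 + 2 * a)) / 2))) :=
      ((hSlim.const_mul _).div_const 2).neg
    have h2 := (Complex.continuous_ofReal.tendsto _).comp ((Real.continuous_exp.tendsto _).comp h1)
    have e : Complex.exp (t * (0 : ℝ) * Complex.I
        - ((r * (1 - r) / (1 + 2 * a) : ℝ) : ℂ) * t ^ 2 / 2)
        = ((Real.exp (-(t ^ 2 * (r * (1 - r)) * (1 / (1 + 2 * a)) / 2)) : ℝ) : ℂ) := by
      rw [Complex.ofReal_exp]; push_cast; congr 1; ring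
    rw [e]
    refine h2.congr fun n => ?_
    simp only [Function.comp_apply]
    rw [div_pow, Real.sq_sqrt (Nat.cast_nonneg n)]
    congr 3
    ring
  refine (tendsto_iff_of_dist ?_).2 hE
  -- At `s = t / √n` the accumulated error is `t ^ 2` times a Cesàro mean of the `L¹` distances,
  -- plus a term of order `n * n ^ (-3 / 2)`.
  have hbound : Tendsto (fun n : ℕ => t ^ 2 *
      ((∑ i ∈ Finset.range n, ∫ ω, |q i ω - r| ∂P) / (n : ℝ)) + 2 * |t| ^ 3 / √(n : ℝ)) atTop
      (𝓝 0) := by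
    have h1 : Tendsto (fun n : ℕ => 2 * |t| ^ 3 / √(n : ℝ)) atTop (𝓝 0) :=
      Tendsto.const_div_atTop (Real.tendsto_sqrt_atTop.comp tendsto_natCast_atTop_atTop) _
    simpa using (hCes.const_mul (t ^ 2)).add h1
  have hev : ∀ᶠ n : ℕ in atTop, |t| ≤ √(n : ℝ) :=
    (Real.tendsto_sqrt_atTop.comp tendsto_natCast_atTop_atTop).eventually_ge_atTop _
  refine squeeze_zero' (Eventually.of_forall fun _ => dist_nonneg) ?_ hbound
  filter_upwards [hev, eventually_ge_atTop 1] with n hn hn1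
  have hn0 : (0 : ℝ) < n := by exact_mod_cast hn1
  have hsq : 0 < √(n : ℝ) := Real.sqrt_pos.2 hn0
  have hss : √(n : ℝ) ^ 2 = n := Real.sq_sqrt hn0.le
  have hs : |t / √(n : ℝ)| ≤ 1 := by
    rw [abs_div, abs_of_pos hsq, div_le_one hsq]; exact hn
  have key := h.norm_charFun_sub_le hr0 hr1 (S := S) rfl hS n hs
  have e1 : charFun (P.map (fun ω => U n ω / √(n : ℝ))) t
      = ∫ ω, Complex.exp ((t / √(n : ℝ) * U n ω : ℝ) * Complex.I) ∂P := by
    rw [charFun_apply_real, integral_map ((h.measurable_U' n).div_const _).aemeasurable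
      (by fun_prop)]
    congr 1; ext ω
    congr 2
    push_cast; ring
  rw [dist_eq_norm, e1]
  refine key.trans (le_of_eq ?_)
  rw [abs_div, abs_of_pos hsq, div_pow, div_pow, hss,
    show √(n : ℝ) ^ 3 = n * √(n : ℝ) by rw [pow_succ, hss]]
  field_simp

end CompensatedRecursion

/-! ### Degrees in recursive trees -/

/-- Every vertex `j ≥ 2` is joined to an earlier vertex. -/
def IsParentSequence (p : ℕ → ℕ) : Prop := ∀ j, 2 ≤ j → 1 ≤ p j ∧ p j < j

/-- The vertices of degree `1` at time `n`. -/
def leaves (p : ℕ → ℕ) (n : ℕ) : Finset ℕ := (Finset.Icc 1 n).filter fun v => deg p v n = 1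

theorem card_leaves (p : ℕ → ℕ) (n : ℕ) : (leaves p n).card = degreeCount p 1 n := rfl

theorem degreeCount_le (p : ℕ → ℕ) (k n : ℕ) : degreeCount p k n ≤ n :=
  (Finset.card_filter_le _ _).trans (by simp)

theorem inDegree_succ (p : ℕ → ℕ) (v : ℕ) {n : ℕ} (hn : 1 ≤ n) :
    inDegree p v (n + 1) = inDegree p v n + if p (n + 1) = v then 1 else 0 := by
  have h : Finset.Icc 2 (n + 1) = insert (n + 1) (Finset.Icc 2 n) := by
    ext j; simp only [Finset.mem_Icc, Finset.mem_insert]; omega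
  rw [inDegree, inDegree, h, Finset.filter_insert]
  split_ifs
  · rw [Finset.card_insert_of_notMem (by simp)]
  · rfl

theorem deg_succ (p : ℕ → ℕ) {v n : ℕ} (hn : 2 ≤ n) (hv : v ≤ n) :
    deg p v (n + 1) = deg p v n + if p (n + 1) = v then 1 else 0 := by
  have h := inDegree_succ p v (n := n) (by omega)
  simp only [deg, h]
  split_ifs <;> omega

namespace IsParentSequence

variable {p : ℕ → ℕ}

theorem two (hp : IsParentSequence p) : p 2 = 1 := by
  have := hp 2 le_rfl; omega

theorem deg_self (hp : IsParentSequence p) (n : ℕ) : deg p n n = 1 := by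
  have h : inDegree p n n = 0 := by
    rw [inDegree, Finset.card_eq_zero, Finset.filter_eq_empty_iff]
    intro j hj
    rw [Finset.mem_Icc] at hj
    have := hp j hj.1
    omega
  unfold deg
  rw [if_neg (by omega), if_neg (by omega), h]

theorem one_le_deg (hp : IsParentSequence p) {v n : ℕ} (hv : v ≤ n) : 1 ≤ deg p v n := by
  unfold deg
  rw [if_neg (by omega)]
  split_ifs with h
  · rw [inDegree, Nat.one_le_iff_ne_zero, ← Nat.pos_iff_ne_zero, Finset.card_pos]
    exact ⟨2, by simp [h.1, h.2, hp.two]⟩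
  · omega

/-- The step from time `1` to time `2` is special: the root gains a child, yet its degree stays `1`
because of the convention for the lone root. -/
theorem deg_mono (hp : IsParentSequence p) {v m n : ℕ} (h1 : 1 ≤ v) (hv : v ≤ m) (hmn : m ≤ n) :
    deg p v m ≤ deg p v n := by
  induction n, hmn using Nat.le_induction with
  | base => exact le_rfl
  | succ n hn ih =>
    by_cases h : 2 ≤ n
    · rw [deg_succ p h (hv.trans hn)]; omega
    · obtain rfl : n = 1 := by omega
      obtain rfl : m = 1 := by omega
      obtain rfl : v = 1 := by omega
      rw [hp.deg_self]
      exact hp.one_le_deg (by omega)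

/-- This makes the delay tractable: the weight that a current leaf had in an outdated tree is known
exactly. -/
theorem deg_eq_one_of_mem_leaves (hp : IsParentSequence p) {v m n : ℕ} (hv : v ∈ leaves p n)
    (hvm : v ≤ m) (hmn : m ≤ n) : deg p v m = 1 := by
  rw [leaves, Finset.mem_filter, Finset.mem_Icc] at hv
  have h1 := hp.deg_mono hv.1.1 hvm hmn
  have h2 := hp.one_le_deg hvm
  omega

/-- The new vertex is a leaf; it destroys a leaf if and only if it is attached to one. -/
theorem degreeCount_succ (hp : IsParentSequence p) {n : ℕ} (hn : 2 ≤ n) :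
    (degreeCount p 1 (n + 1) : ℝ)
      = degreeCount p 1 n + 1 - if deg p (p (n + 1)) n = 1 then 1 else 0 := by
  have hmem : p (n + 1) ∈ Finset.Icc 1 n := by
    have := hp (n + 1) (by omega)
    rw [Finset.mem_Icc]; omega
  rw [degreeCount, degreeCount, Finset.card_filter, Finset.card_filter,
    Finset.sum_Icc_succ_top (by omega), hp.deg_self, if_pos rfl]
  push_cast
  have h : ∀ v ∈ Finset.Icc 1 n, (if deg p v (n + 1) = 1 then (1 : ℝ) else 0)
      = (if deg p v n = 1 then (1 : ℝ) else 0)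
        - if p (n + 1) = v then (if deg p v n = 1 then (1 : ℝ) else 0) else 0 := by
    intro v hv
    rw [Finset.mem_Icc] at hv
    have h1 := hp.one_le_deg hv.2
    rw [deg_succ p hn hv.2]
    by_cases h2 : p (n + 1) = v
    · simp [h2, show deg p v n ≠ 0 by omega]
    · simp [h2]
  rw [Finset.sum_congr rfl h, Finset.sum_sub_distrib, Finset.sum_ite_eq, if_pos hmem]
  ring

theorem sum_deg (hp : IsParentSequence p) {n : ℕ} (hn : 2 ≤ n) :
    ∑ v ∈ Finset.Icc 1 n, (deg p v n : ℝ) = 2 * n - 2 := by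
  induction n, hn using Nat.le_induction with
  | base =>
    have h1 : deg p 1 2 = 1 := by
      simp [deg, inDegree, Finset.filter_singleton, hp.two]
    rw [Finset.sum_Icc_succ_top (by omega), hp.deg_self]
    norm_num [h1]
  | succ n hn ih =>
    have hmem : p (n + 1) ∈ Finset.Icc 1 n := by
      have := hp (n + 1) (by omega)
      rw [Finset.mem_Icc]; omega
    have h : ∀ v ∈ Finset.Icc 1 n, (deg p v (n + 1) : ℝ)
        = deg p v n + if p (n + 1) = v then 1 else 0 := by
      intro v hv
      rw [Finset.mem_Icc] at hv
      rw [deg_succ p hn hv.2]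
      push_cast; rfl
    rw [Finset.sum_Icc_succ_top (by omega), hp.deg_self, Finset.sum_congr rfl h,
      Finset.sum_add_distrib, ih, Finset.sum_ite_eq, if_pos hmem]
    push_cast; ring

end IsParentSequence

/-- The total weight of the tree at time `m`. -/
noncomputable def totalWeight (α : ℝ) (m : ℕ) : ℝ := if m = 1 then 1 + α else (2 + α) * m - 2

theorem IsParentSequence.sum_affine {p : ℕ → ℕ} (hp : IsParentSequence p) (α : ℝ) {m : ℕ}
    (hm : 1 ≤ m) : ∑ v ∈ Finset.Icc 1 m, affine α (deg p v m) = totalWeight α m := by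
  unfold affine totalWeight
  split_ifs with h
  · subst h
    simp [hp.deg_self]
  · rw [Finset.sum_add_distrib, hp.sum_deg (by omega)]
    simp
    ring

theorem le_totalWeight (α : ℝ) {m : ℕ} (hm : 1 ≤ m) :
    (1 + α) * m ≤ totalWeight α m := by
  unfold totalWeight
  split_ifs with h
  · subst h; simp
  · have : (2 : ℝ) ≤ m := by exact_mod_cast (by omega : 2 ≤ m)
    linarith

theorem totalWeight_pos {α : ℝ} (hα : -1 < α) {m : ℕ} (hm : 1 ≤ m) : 0 < totalWeight α m := by
  refine lt_of_lt_of_le ?_ (le_totalWeight α hm)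
  have : (0 : ℝ) < m := by exact_mod_cast hm
  have : 0 < 1 + α := by linarith
  positivity

theorem gam_pos {α : ℝ} (hα : -1 < α) : 0 < gam α := div_pos (by linarith) (by linarith)

theorem gam_le_one {α : ℝ} (hα : -1 < α) : gam α ≤ 1 :=
  (div_le_one (by linarith)).2 (by linarith)

/-- For `m ≥ 2` the discrepancy comes only from the `-2` in the total weight and equals `-(1 + α) /
totalWeight α m * (2 / (2 + α))`. At `m = 1` it is a difference of two numbers in `[0, 1]`. -/
theorem abs_gam_sub_le {α : ℝ} (hα : -1 < α) {m : ℕ} (hm : 1 ≤ m) :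
    |gam α - m * ((1 + α) / totalWeight α m)| ≤ 2 / m := by
  have h2 : 0 < 2 + α := by linarith
  by_cases h : m = 1
  · subst h
    have h1 : (1 + α) ≠ 0 := by linarith
    have := gam_pos hα
    have := gam_le_one hα
    rw [totalWeight, if_pos rfl, div_self h1, abs_le]
    constructor <;> norm_num <;> linarith
  · have hm2 : (2 : ℝ) ≤ m := by exact_mod_cast (by omega : 2 ≤ m)
    have hS := totalWeight_pos hα hm
    have hS' := le_totalWeight α hm
    have e : totalWeight α m = (2 + α) * m - 2 := if_neg h
    have h3 : gam α - m * ((1 + α) / totalWeight α m)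
        = -((1 + α) / totalWeight α m * (2 / (2 + α))) := by
      rw [gam]
      field_simp
      rw [e]; ring
    rw [h3, abs_neg, abs_of_nonneg (by
      have : 0 < 1 + α := by linarith
      positivity)]
    have h4 : (1 + α) / totalWeight α m ≤ 1 / m := by
      rw [div_le_div_iff₀ hS (by linarith)]; linarith
    have h5 : 2 / (2 + α) ≤ 2 := by
      rw [div_le_iff₀ h2]; linarith
    calc _ ≤ 1 / (m : ℝ) * 2 := mul_le_mul h4 h5 (by positivity) (by positivity)
      _ = _ := by ring

/-! ### Attachment probabilities in a fixed tree -/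

namespace IsParentSequence

variable {p : ℕ → ℕ}

theorem affine_deg_pos (hp : IsParentSequence p) {α : ℝ} (hα : -1 < α) {v m : ℕ} (hv : v ≤ m) :
    0 < affine α (deg p v m) := by
  have : (1 : ℝ) ≤ deg p v m := by exact_mod_cast hp.one_le_deg hv
  rw [affine]; linarith

theorem attachProb_nonneg (hp : IsParentSequence p) {α : ℝ} (hα : -1 < α) (m v : ℕ) :
    0 ≤ attachProb (affine α) p m v := by
  unfold attachProb
  split_ifs with h
  · exact div_nonneg (hp.affine_deg_pos hα (Finset.mem_Icc.1 h).2).le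
      (Finset.sum_nonneg fun u hu => (hp.affine_deg_pos hα (Finset.mem_Icc.1 hu).2).le)
  · exact le_rfl

theorem sum_attachProb_le_one (hp : IsParentSequence p) {α : ℝ} (hα : -1 < α) (m : ℕ)
    (s : Finset ℕ) : ∑ v ∈ s, attachProb (affine α) p m v ≤ 1 := by
  unfold attachProb
  rw [← Finset.sum_filter, ← Finset.sum_div]
  refine div_le_one_of_le₀ (Finset.sum_le_sum_of_subset_of_nonneg ?_ ?_) ?_
  · intro v hv
    exact (Finset.mem_filter.1 hv).2
  · exact fun u hu _ => (hp.affine_deg_pos hα (Finset.mem_Icc.1 hu).2).le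
  · exact Finset.sum_nonneg fun u hu => (hp.affine_deg_pos hα (Finset.mem_Icc.1 hu).2).le

/-- Among the leaves at time `n`, those born by time `m` were leaves then, each with weight `1 + α`;
the younger ones are invisible. -/
theorem sum_leaves_attachProb (hp : IsParentSequence p) (α : ℝ) {m n : ℕ} (hm : 1 ≤ m)
    (hmn : m ≤ n) :
    ∑ v ∈ leaves p n, attachProb (affine α) p m v
      = ((leaves p n).filter (· ≤ m)).card * ((1 + α) / totalWeight α m) := by
  have h : ∀ v ∈ leaves p n, attachProb (affine α) p m v
      = if v ≤ m then (1 + α) / totalWeight α m else 0 := by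
    intro v hv
    have hv1 : 1 ≤ v := (Finset.mem_Icc.1 (Finset.mem_filter.1 hv).1).1
    rw [attachProb, hp.sum_affine α hm]
    by_cases h : v ≤ m
    · rw [if_pos (Finset.mem_Icc.2 ⟨hv1, h⟩), if_pos h, hp.deg_eq_one_of_mem_leaves hv h hmn]
      simp [affine]
    · rw [if_neg (by simp [h]), if_neg h]
  rw [Finset.sum_congr rfl h, ← Finset.sum_filter, Finset.sum_const, nsmul_eq_mul]

end IsParentSequence

theorem card_leaves_filter_le (p : ℕ → ℕ) (n m : ℕ) :
    ((leaves p n).filter (· ≤ m)).card ≤ m := by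
  calc _ ≤ (Finset.Icc 1 m).card := Finset.card_le_card fun v hv => by
        rw [leaves, Finset.mem_filter, Finset.mem_filter, Finset.mem_Icc] at hv
        exact Finset.mem_Icc.2 ⟨hv.1.1.1, hv.2⟩
    _ = m := by simp

theorem card_leaves_filter_le_one (p : ℕ → ℕ) {n : ℕ} (hn : 1 ≤ n) :
    ((leaves p n).filter (· ≤ 1)).card = if deg p 1 n = 1 then 1 else 0 := by
  have h : (leaves p n).filter (· ≤ 1) = ({1} : Finset ℕ).filter fun v => deg p v n = 1 := by
    ext v
    simp only [leaves, Finset.mem_filter, Finset.mem_Icc, Finset.mem_singleton]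
    constructor
    · rintro ⟨⟨h1, h2⟩, h3⟩; exact ⟨by omega, h2⟩
    · rintro ⟨rfl, h2⟩; exact ⟨⟨⟨le_rfl, hn⟩, h2⟩, le_rfl⟩
  rw [h, Finset.filter_singleton]
  split_ifs <;> simp

/-! ### The visible time -/

theorem one_le_infoTime (β : ℝ) (n : ℕ) (x : ℝ) : 1 ≤ infoTime β n x := le_max_right _ _

theorem measurable_infoTime (β : ℝ) (n : ℕ) : Measurable (infoTime β n) := by
  unfold infoTime floorPlus
  fun_prop

theorem infoTime_le {β : ℝ} {n : ℕ} (hn : 1 ≤ n) {x : ℝ} (hx : 0 ≤ x) : infoTime β n x ≤ n := by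
  refine max_le (Nat.floor_le_of_le ?_) hn
  have : 0 ≤ (n : ℝ) ^ β * x := by positivity
  linarith

theorem infoTime_eq_one {β : ℝ} {n : ℕ} {x : ℝ} (h : (n : ℝ) - (n : ℝ) ^ β * x < 1) :
    infoTime β n x = 1 := by
  unfold infoTime floorPlus
  rw [Nat.floor_eq_zero.2 h]; rfl

theorem infoTime_eq_floor {β : ℝ} {n : ℕ} {x : ℝ} (h : 1 ≤ (n : ℝ) - (n : ℝ) ^ β * x) :
    infoTime β n x = ⌊(n : ℝ) - (n : ℝ) ^ β * x⌋₊ :=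
  max_eq_left (Nat.one_le_floor_iff _ |>.2 h)

theorem infoTime_le_sub {β : ℝ} {n : ℕ} {x : ℝ} (h : 1 ≤ (n : ℝ) - (n : ℝ) ^ β * x) :
    (infoTime β n x : ℝ) ≤ (n : ℝ) - (n : ℝ) ^ β * x := by
  rw [infoTime_eq_floor h]
  exact Nat.floor_le (by linarith)

theorem sub_lt_infoTime_add_one {β : ℝ} {n : ℕ} {x : ℝ} (h : 1 ≤ (n : ℝ) - (n : ℝ) ^ β * x) :
    (n : ℝ) - (n : ℝ) ^ β * x < infoTime β n x + 1 := by
  rw [infoTime_eq_floor h]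
  exact Nat.lt_floor_add_one _

theorem le_infoTime_iff {β : ℝ} {n : ℕ} {x : ℝ} (h : 1 ≤ (n : ℝ) - (n : ℝ) ^ β * x) (i : ℕ) :
    i ≤ infoTime β n x ↔ (i : ℝ) ≤ (n : ℝ) - (n : ℝ) ^ β * x := by
  rw [infoTime_eq_floor h, Nat.le_floor_iff (by linarith)]

/-- The delays for which the visible time is not truncated. -/
def untruncated (β : ℝ) (n : ℕ) : Set ℝ := {x : ℝ | 1 ≤ (n : ℝ) - (n : ℝ) ^ β * x}

theorem measurableSet_untruncated (β : ℝ) (n : ℕ) : MeasurableSet (untruncated β n) :=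
  measurableSet_le measurable_const (by fun_prop)

theorem compl_untruncated (β : ℝ) (n : ℕ) :
    (untruncated β n)ᶜ = {x : ℝ | (n : ℝ) - (n : ℝ) ^ β * x < 1} := by
  ext x; simp [untruncated]

/-- The reciprocal of the visible time, on the event that the latter is not truncated. -/
noncomputable def reciprocalTime (β : ℝ) (n : ℕ) : ℝ → ℝ :=
  (untruncated β n).indicator fun x => 1 / (infoTime β n x : ℝ)

/-- The expected reciprocal of the visible time. -/
noncomputable def meanReciprocal (β : ℝ) (μ : Measure ℝ) (n : ℕ) : ℝ :=
  ∫ x, reciprocalTime β n x ∂μ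

/-- The probability that the visible time is truncated. -/
noncomputable def truncProb (β : ℝ) (μ : Measure ℝ) (n : ℕ) : ℝ := μ.real (untruncated β n)ᶜ

theorem contraction_eq (α β : ℝ) (μ : Measure ℝ) (n : ℕ) :
    contraction α β μ n = 1 - gam α * meanReciprocal β μ n := rfl

theorem measurable_reciprocalTime (β : ℝ) (n : ℕ) : Measurable (reciprocalTime β n) := by
  refine Measurable.indicator ?_ (measurableSet_untruncated β n)
  exact measurable_const.div (measurable_from_nat.comp (measurable_infoTime β n))

theorem reciprocalTime_nonneg (β : ℝ) (n : ℕ) (x : ℝ) : 0 ≤ reciprocalTime β n x :=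
  Set.indicator_nonneg (fun _ _ => by positivity) _

theorem reciprocalTime_le_one (β : ℝ) (n : ℕ) (x : ℝ) : reciprocalTime β n x ≤ 1 := by
  refine Set.indicator_le' (fun x _ => ?_) (fun _ _ => zero_le_one) x
  have : (1 : ℝ) ≤ infoTime β n x := by exact_mod_cast one_le_infoTime β n x
  exact div_le_one_of_le₀ this (by linarith)

/-- The integrand of `delayCost`. -/
noncomputable def delayCostFun (β : ℝ) (n : ℕ) : ℝ → ℝ :=
  (untruncated β n).indicator fun x => (n : ℝ) ^ β * x / (infoTime β n x : ℝ)

theorem measurable_delayCostFun (β : ℝ) (n : ℕ) : Measurable (delayCostFun β n) := by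
  refine Measurable.indicator ?_ (measurableSet_untruncated β n)
  exact (measurable_id.const_mul _).div (measurable_from_nat.comp (measurable_infoTime β n))

theorem delayCostFun_nonneg (β : ℝ) (n : ℕ) {x : ℝ} (hx : 0 ≤ x) : 0 ≤ delayCostFun β n x := by
  unfold delayCostFun
  classical
  rw [Set.indicator_apply]
  split_ifs <;> positivity

theorem delayCostFun_le (β : ℝ) (n : ℕ) {x : ℝ} (hx : 0 ≤ x) : delayCostFun β n x ≤ n := by
  unfold delayCostFun
  classical
  rw [Set.indicator_apply]
  split_ifs with h
  · have h1 : (1 : ℝ) ≤ infoTime β n x := by exact_mod_cast one_le_infoTime β n x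
    have h2 : 0 ≤ (n : ℝ) ^ β * x := by positivity
    have h3 : 1 ≤ (n : ℝ) - (n : ℝ) ^ β * x := h
    exact (div_le_self h2 h1).trans (by linarith)
  · positivity

/-- Without truncation the visible time `m` satisfies `m ≤ n < m + 1 + n ^ β * x`; both bounds
result from dividing by `m`. -/
theorem bound_mul_reciprocalTime {β : ℝ} {n : ℕ} (hn : 1 ≤ n) {x : ℝ} (hx : 0 ≤ x) :
    (untruncated β n).indicator 1 x ≤ n * reciprocalTime β n x ∧
      n * reciprocalTime β n x
        ≤ (untruncated β n).indicator 1 x + (delayCostFun β n x + reciprocalTime β n x) := by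
  unfold reciprocalTime delayCostFun
  classical
  simp only [Set.indicator_apply]
  split_ifs with h
  · have h1 : (1 : ℝ) ≤ infoTime β n x := by exact_mod_cast one_le_infoTime β n x
    have h2 : (infoTime β n x : ℝ) ≤ n := by exact_mod_cast infoTime_le hn hx
    have h3 := sub_lt_infoTime_add_one h
    have h0 : (0 : ℝ) < infoTime β n x := by linarith
    simp only [Pi.one_apply]
    constructor
    · rw [mul_one_div, le_div_iff₀ h0]; linarith
    · rw [← add_div, mul_one_div, div_le_iff₀ h0, add_mul, div_mul_cancel₀ _ h0.ne']
      linarith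
  · simp

theorem meanReciprocal_nonneg {β : ℝ} {μ : Measure ℝ} (n : ℕ) : 0 ≤ meanReciprocal β μ n :=
  integral_nonneg (reciprocalTime_nonneg β n)

theorem truncProb_nonneg {β : ℝ} {μ : Measure ℝ} (n : ℕ) : 0 ≤ truncProb β μ n :=
  measureReal_nonneg

theorem delayCost_nonneg {β : ℝ} {μ : Measure ℝ} (hμ : ∀ᵐ x ∂μ, 0 ≤ x)
    (n : ℕ) : 0 ≤ delayCost β μ n :=
  integral_nonneg_of_ae (hμ.mono fun _ hx => delayCostFun_nonneg β n hx)

theorem contraction_le_one {α β : ℝ} {μ : Measure ℝ} (hα : -1 < α) (n : ℕ) :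
    contraction α β μ n ≤ 1 := by
  rw [contraction_eq, sub_le_self_iff]
  exact mul_nonneg (gam_pos hα).le (meanReciprocal_nonneg n)

/-! ### Asymptotics of the expected reciprocal time and of the truncation probability -/

section Delay

variable {β : ℝ} {μ : Measure ℝ} [IsProbabilityMeasure μ]

theorem integrable_reciprocalTime (n : ℕ) : Integrable (reciprocalTime β n) μ :=
  integrable_of_measurable_of_norm_le (measurable_reciprocalTime β n) (C := 1) fun x => by
    rw [Real.norm_eq_abs, abs_of_nonneg (reciprocalTime_nonneg β n x)]
    exact reciprocalTime_le_one β n x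

theorem meanReciprocal_le_one (n : ℕ) : meanReciprocal β μ n ≤ 1 := by
  calc _ ≤ ∫ _, (1 : ℝ) ∂μ := integral_mono (integrable_reciprocalTime n) (integrable_const _)
        (reciprocalTime_le_one β n)
    _ = 1 := by simp

theorem contraction_nonneg {α : ℝ} (hα : -1 < α) (n : ℕ) : 0 ≤ contraction α β μ n := by
  rw [contraction_eq, sub_nonneg]
  exact mul_le_one₀ (gam_le_one hα) (meanReciprocal_nonneg n) (meanReciprocal_le_one n)

theorem integral_indicator_untruncated (n : ℕ) :
    ∫ x, (untruncated β n).indicator 1 x ∂μ = 1 - truncProb β μ n := by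
  rw [integral_indicator_one (measurableSet_untruncated β n), truncProb,
    probReal_compl_eq_one_sub (measurableSet_untruncated β n)]
  ring

theorem integrable_indicator_untruncated (n : ℕ) :
    Integrable ((untruncated β n).indicator (1 : ℝ → ℝ)) μ :=
  (integrable_const (1 : ℝ)).indicator (measurableSet_untruncated β n)

theorem integrable_delayCostFun (hμ : ∀ᵐ x ∂μ, 0 ≤ x)
    (n : ℕ) : Integrable (delayCostFun β n) μ := by
  refine Integrable.of_bound (measurable_delayCostFun β n).aestronglyMeasurable n ?_
  filter_upwards [hμ] with x hx
  rw [Real.norm_eq_abs, abs_of_nonneg (delayCostFun_nonneg β n hx)]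
  exact delayCostFun_le β n hx

theorem bound_mul_meanReciprocal (hμ : ∀ᵐ x ∂μ, 0 ≤ x) {n : ℕ} (hn : 1 ≤ n) :
    1 - truncProb β μ n ≤ n * meanReciprocal β μ n ∧
      n * meanReciprocal β μ n
        ≤ 1 - truncProb β μ n + (delayCost β μ n + meanReciprocal β μ n) := by
  have i1 := integrable_reciprocalTime (β := β) (μ := μ) n
  have i2 := integrable_delayCostFun (β := β) hμ n
  have i3 := integrable_indicator_untruncated (β := β) (μ := μ) n
  have e : delayCost β μ n = ∫ x, delayCostFun β n x ∂μ := rfl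
  rw [← integral_indicator_untruncated, e, meanReciprocal, ← integral_const_mul,
    ← integral_add i2 i1]
  constructor
  · refine integral_mono_ae i3 (i1.const_mul _) ?_
    filter_upwards [hμ] with x hx using (bound_mul_reciprocalTime hn hx).1
  · have i4 : Integrable (fun x => delayCostFun β n x + reciprocalTime β n x) μ := i2.add i1
    rw [← integral_add i3 i4]
    refine integral_mono_ae (i1.const_mul _) (i3.add i4) ?_
    filter_upwards [hμ] with x hx using (bound_mul_reciprocalTime hn hx).2

theorem meanReciprocal_le (hμ : ∀ᵐ x ∂μ, 0 ≤ x) {n : ℕ} (hn : 1 ≤ n) :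
    meanReciprocal β μ n ≤ (2 + delayCost β μ n) / n := by
  have hn0 : (0 : ℝ) < n := by exact_mod_cast hn
  rw [le_div_iff₀ hn0]
  linarith [(bound_mul_meanReciprocal (β := β) hμ hn).2, meanReciprocal_le_one (β := β) (μ := μ) n,
    truncProb_nonneg (β := β) (μ := μ) n]

theorem abs_mul_meanReciprocal_sub_one_le (hμ : ∀ᵐ x ∂μ, 0 ≤ x) {n : ℕ} (hn : 1 ≤ n) :
    |n * meanReciprocal β μ n - 1|
      ≤ truncProb β μ n + (delayCost β μ n + meanReciprocal β μ n) := by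
  have h := bound_mul_meanReciprocal (β := β) hμ hn
  have := truncProb_nonneg (β := β) (μ := μ) n
  have := delayCost_nonneg (β := β) hμ n
  have := meanReciprocal_nonneg (β := β) (μ := μ) n
  rw [abs_le]
  constructor <;> linarith [h.1, h.2]

/-- Dominated convergence: as `β < 1`, for each fixed `x` eventually `n ^ β * x ≤ n / 2`, and then
there is no truncation. -/
theorem tendsto_truncProb (hβ : β < 1) : Tendsto (truncProb β μ) atTop (𝓝 0) := by
  have h : Tendsto (fun n : ℕ => ∫ x, (untruncated β n)ᶜ.indicator (1 : ℝ → ℝ) x ∂μ) atTop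
      (𝓝 (∫ _, (0 : ℝ) ∂μ)) := by
    refine tendsto_integral_of_dominated_convergence (fun _ => 1) (fun n => ?_)
      (integrable_const _) (fun n => ae_of_all _ fun x => ?_) (ae_of_all _ fun x => ?_)
    · exact (measurable_const.indicator
        (measurableSet_untruncated β n).compl).aestronglyMeasurable
    · classical
      rw [Set.indicator_apply]; split_ifs <;> simp
    · refine tendsto_const_nhds.congr' ?_
      have h1 : Tendsto (fun n : ℕ => (n : ℝ) ^ (1 - β)) atTop atTop :=
        (tendsto_rpow_atTop (by linarith)).comp tendsto_natCast_atTop_atTop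
      filter_upwards [h1.eventually_ge_atTop (2 * |x|), eventually_ge_atTop 2] with n hn hn2
      have hn0 : (2 : ℝ) ≤ n := by exact_mod_cast hn2
      have h2 : (n : ℝ) ^ β * (n : ℝ) ^ (1 - β) = n := by
        rw [← Real.rpow_add (by linarith)]; simp
      have h3 : 0 < (n : ℝ) ^ β := Real.rpow_pos_of_pos (by linarith) _
      have h4 : (n : ℝ) ^ β * x ≤ n / 2 := by
        nlinarith [le_abs_self x, mul_le_mul_of_nonneg_left hn h3.le]
      rw [Set.indicator_of_notMem]
      rw [Set.notMem_compl_iff]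
      change 1 ≤ (n : ℝ) - (n : ℝ) ^ β * x
      linarith
  simp only [integral_zero] at h
  refine h.congr fun n => ?_
  rw [integral_indicator_one (measurableSet_untruncated β n).compl]; rfl

theorem tendsto_meanReciprocal (hμ : ∀ᵐ x ∂μ, 0 ≤ x)
    {c : ℝ} (hc : Tendsto (fun n => delayCost β μ n) atTop (𝓝 c)) :
    Tendsto (meanReciprocal β μ) atTop (𝓝 0) := by
  have h : Tendsto (fun n : ℕ => (2 + delayCost β μ n) * (n : ℝ)⁻¹) atTop (𝓝 0) := by
    simpa using (hc.const_add 2).mul (tendsto_inv_atTop_nhds_zero_nat (𝕜 := ℝ))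
  refine squeeze_zero' (Eventually.of_forall meanReciprocal_nonneg) ?_ h
  filter_upwards [eventually_ge_atTop 1] with n hn
  exact meanReciprocal_le hμ hn

theorem tendsto_sqrt_mul_meanReciprocal (hμ : ∀ᵐ x ∂μ, 0 ≤ x) {c : ℝ}
    (hc : Tendsto (fun n => delayCost β μ n) atTop (𝓝 c)) :
    Tendsto (fun n : ℕ => √(n : ℝ) * meanReciprocal β μ n) atTop (𝓝 0) := by
  have h0 : Tendsto (fun n : ℕ => (√(n : ℝ))⁻¹) atTop (𝓝 0) :=
    (Real.tendsto_sqrt_atTop.comp tendsto_natCast_atTop_atTop).inv_tendsto_atTop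
  have h : Tendsto (fun n : ℕ => (2 + delayCost β μ n) * (√(n : ℝ))⁻¹) atTop (𝓝 0) := by
    simpa using (hc.const_add 2).mul h0
  refine squeeze_zero' (Eventually.of_forall fun n =>
    mul_nonneg (Real.sqrt_nonneg _) (meanReciprocal_nonneg n)) ?_ h
  filter_upwards [eventually_ge_atTop 1] with n hn
  refine (mul_le_mul_of_nonneg_left (meanReciprocal_le hμ hn) (Real.sqrt_nonneg _)).trans
    (le_of_eq ?_)
  have hn0 : (0 : ℝ) < n := by exact_mod_cast hn
  have hs : 0 < √(n : ℝ) := Real.sqrt_pos.2 hn0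
  have h2 : √(n : ℝ) * √(n : ℝ) = n := Real.mul_self_sqrt hn0.le
  field_simp
  rw [sq, h2, mul_comm]

theorem tendsto_mul_meanReciprocal (hμ : ∀ᵐ x ∂μ, 0 ≤ x) (hβ : β < 1)
    (hc : Tendsto (fun n => delayCost β μ n) atTop (𝓝 0)) :
    Tendsto (fun n : ℕ => (n : ℝ) * meanReciprocal β μ n) atTop (𝓝 1) := by
  rw [tendsto_iff_dist_tendsto_zero]
  have h := (tendsto_truncProb (μ := μ) hβ).add (hc.add (tendsto_meanReciprocal hμ hc))
  rw [add_zero, add_zero] at h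
  refine squeeze_zero' (Eventually.of_forall fun _ => dist_nonneg) ?_ h
  filter_upwards [eventually_ge_atTop 1] with n hn
  exact abs_mul_meanReciprocal_sub_one_le hμ hn

/-- A delay that truncates the visible time at `n` is costly at `2 n`, or truncates there too. -/
theorem truncProb_le (hμ : ∀ᵐ x ∂μ, 0 ≤ x) (hβ0 : 0 ≤ β) {n : ℕ} (hn : 2 ≤ n) :
    truncProb β μ n ≤ truncProb β μ (2 * n) + 3 * delayCost β μ (2 * n) := by
  have e : delayCost β μ (2 * n) = ∫ x, delayCostFun β (2 * n) x ∂μ := rfl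
  have e2 : ∀ m, truncProb β μ m = ∫ x, (untruncated β m)ᶜ.indicator (1 : ℝ → ℝ) x ∂μ := fun m =>
    (integral_indicator_one (measurableSet_untruncated β m).compl).symm
  have i1 : ∀ m, Integrable ((untruncated β m)ᶜ.indicator (1 : ℝ → ℝ)) μ := fun m =>
    (integrable_const (1 : ℝ)).indicator (measurableSet_untruncated β m).compl
  have i2 := integrable_delayCostFun (β := β) hμ (2 * n)
  rw [e2, e2, e, ← integral_const_mul, ← integral_add (i1 _) (i2.const_mul 3)]
  refine integral_mono_ae (i1 _) ((i1 _).add (i2.const_mul 3)) ?_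
  filter_upwards [hμ] with x hx
  have hnn := delayCostFun_nonneg β (2 * n) hx
  by_cases h1 : x ∈ untruncated β (2 * n)
  · by_cases h2 : x ∈ untruncated β n
    · simp [h1, h2, hnn]
    · have hn2 : (2 : ℝ) ≤ n := by exact_mod_cast hn
      have h3 : (n : ℝ) - (n : ℝ) ^ β * x < 1 := not_le.1 h2
      have h4 : (n : ℝ) ^ β ≤ ((2 * n : ℕ) : ℝ) ^ β :=
        Real.rpow_le_rpow (by linarith) (by push_cast; linarith) hβ0
      have h5 := mul_le_mul_of_nonneg_right h4 hx
      have h6 := infoTime_le_sub h1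
      have h7 : (1 : ℝ) ≤ infoTime β (2 * n) x := by exact_mod_cast one_le_infoTime β (2 * n) x
      -- The numerator exceeds `n - 1`, hence the visible time at `2 * n` is below `n + 1`, and `n +
      -- 1 ≤ 3 * (n - 1)` as soon as `n ≥ 2`.
      have h8 : 1 ≤ 3 * (((2 * n : ℕ) : ℝ) ^ β * x / (infoTime β (2 * n) x : ℝ)) := by
        rw [← mul_div_assoc, le_div_iff₀ (by linarith)]
        have : ((2 * n : ℕ) : ℝ) = 2 * n := by push_cast; ring
        linarith
      simpa [h1, h2, delayCostFun] using h8
  · have : (untruncated β n)ᶜ.indicator (1 : ℝ → ℝ) x ≤ 1 :=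
      Set.indicator_le' (fun _ _ => le_rfl) (fun _ _ => zero_le_one) x
    simp [h1]
    linarith

/-- Iterating `truncProb_le` along `n, 2 n, 4 n, …` bounds the truncation probability by a sum of
delay costs, since it vanishes at the far end. With costs `o(1 / √m)` the sum is geometric and hence
`o(1 / √n)`. -/
theorem tendsto_sqrt_mul_truncProb (hμ : ∀ᵐ x ∂μ, 0 ≤ x) (hβ0 : 0 ≤ β) (hβ1 : β < 1)
    (hc : Tendsto (fun n : ℕ => √(n : ℝ) * delayCost β μ n) atTop (𝓝 0)) :
    Tendsto (fun n : ℕ => √(n : ℝ) * truncProb β μ n) atTop (𝓝 0) := by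
  rw [Metric.tendsto_atTop] at hc ⊢
  intro ε hε
  obtain ⟨N, hN⟩ := hc (ε / 18) (by positivity)
  refine ⟨max N 2, fun n hn => ?_⟩
  have hcost : ∀ m, N ≤ m → √(m : ℝ) * delayCost β μ m ≤ ε / 18 := fun m hm => by
    have := hN m hm
    rw [Real.dist_eq, sub_zero] at this
    exact (le_abs_self _).trans this.le
  have key : ∀ J m : ℕ, max N 2 ≤ m →
      truncProb β μ m ≤ truncProb β μ (2 ^ J * m) + (ε / 2) * (1 / √(m : ℝ)) := by
    intro J
    induction J with
    | zero => intro m hm; simp; positivity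
    | succ J ih =>
      intro m hm
      have hm2 : 2 ≤ m := (le_max_right _ _).trans hm
      have h1 := ih (2 * m) (by omega)
      have h2 := truncProb_le (β := β) hμ hβ0 hm2
      have h3 := hcost (2 * m) (by have := (le_max_left N 2).trans hm; omega)
      rw [show 2 ^ J * (2 * m) = 2 ^ (J + 1) * m by ring] at h1
      have hm0 : (0 : ℝ) < m := by positivity
      set a := √(m : ℝ)
      set b := √((2 * m : ℕ) : ℝ)
      have ha : 0 < a := Real.sqrt_pos.2 hm0
      have ha2 : a * a = m := Real.mul_self_sqrt hm0.le
      have hb2 : b * b = 2 * m := by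
        rw [Real.mul_self_sqrt (by positivity)]; push_cast; ring
      have hb0 : 0 ≤ b := Real.sqrt_nonneg _
      -- The ratio `√2` is at least `4 / 3`. One doubling then costs at most `3 * (ε / 18) * (3 / 4)
      -- = ε / 8`, and the old bound shrinks from `ε / 2` to `3 ε / 8` (all over `√m`), so the bound
      -- `ε / 2` reproduces itself.
      have hab : 4 * a ≤ 3 * b := by
        by_contra hcon
        nlinarith
      have hb : 0 < b := by linarith
      have h4 : delayCost β μ (2 * m) ≤ ε / 18 * (1 / b) := by
        rw [mul_one_div, le_div_iff₀ hb]; linarith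
      have h5 : 1 / b ≤ 3 / 4 * (1 / a) := by
        rw [mul_one_div, div_le_div_iff₀ hb ha]; linarith
      have h6 : ε * (1 / b) ≤ ε * (3 / 4 * (1 / a)) := mul_le_mul_of_nonneg_left h5 hε.le
      linarith
  have hn2 : 2 ≤ n := (le_max_right _ _).trans hn
  have hs : 0 < √(n : ℝ) := Real.sqrt_pos.2 (by positivity)
  have hlim : Tendsto (fun J : ℕ => truncProb β μ (2 ^ J * n) + (ε / 2) * (1 / √(n : ℝ))) atTop
      (𝓝 (0 + (ε / 2) * (1 / √(n : ℝ)))) := by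
    refine ((tendsto_truncProb hβ1).comp ?_).add_const _
    exact (tendsto_pow_atTop_atTop_of_one_lt one_lt_two).atTop_mul_const' (by omega)
  have h := ge_of_tendsto' hlim fun J => key J n hn
  rw [Real.dist_eq, sub_zero, abs_of_nonneg (mul_nonneg hs.le (truncProb_nonneg n))]
  rw [zero_add, mul_one_div, le_div_iff₀ hs] at h
  linarith

end Delay

/-! ### The drift of the number of leaves -/

/-- The conditional probability, given the tree at time `n`, that vertex `n + 1` is attached to a
leaf. -/
noncomputable def leafAttachProb (α β : ℝ) (μ : Measure ℝ) (p : ℕ → ℕ) (n : ℕ) : ℝ :=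
  ∫ x, ∑ v ∈ leaves p n, attachProb (affine α) p (infoTime β n x) v ∂μ

theorem measurable_sum_attachProb (f : ℕ → ℝ) (β : ℝ) (p : ℕ → ℕ) (n : ℕ) (s : Finset ℕ) :
    Measurable fun x => ∑ v ∈ s, attachProb f p (infoTime β n x) v :=
  (measurable_from_nat (f := fun m => ∑ v ∈ s, attachProb f p m v)).comp (measurable_infoTime β n)

theorem IsParentSequence.leafAttachProb_nonneg {α β : ℝ} {μ : Measure ℝ} {p : ℕ → ℕ}
    (hp : IsParentSequence p) (hα : -1 < α) (n : ℕ) :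
    0 ≤ leafAttachProb α β μ p n :=
  integral_nonneg fun _ => Finset.sum_nonneg fun v _ => hp.attachProb_nonneg hα _ v

section

variable {α β : ℝ} {μ : Measure ℝ} [IsProbabilityMeasure μ] {p : ℕ → ℕ}

theorem IsParentSequence.integrable_sum_attachProb (hp : IsParentSequence p) (hα : -1 < α) (n : ℕ)
    (s : Finset ℕ) :
    Integrable (fun x => ∑ v ∈ s, attachProb (affine α) p (infoTime β n x) v) μ :=
  integrable_of_measurable_of_norm_le (measurable_sum_attachProb _ β p n s) (C := 1) fun x => by
    rw [Real.norm_eq_abs, abs_of_nonneg (Finset.sum_nonneg fun v _ => hp.attachProb_nonneg hα _ v)]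
    exact hp.sum_attachProb_le_one hα _ _

theorem IsParentSequence.leafAttachProb_le_one (hp : IsParentSequence p) (hα : -1 < α) (n : ℕ) :
    leafAttachProb α β μ p n ≤ 1 := by
  calc _ ≤ ∫ _, (1 : ℝ) ∂μ := integral_mono (hp.integrable_sum_attachProb hα n _)
        (integrable_const _) fun x => hp.sum_attachProb_le_one hα _ _
    _ = 1 := by simp

theorem integrable_reciprocalTime_mul (n : ℕ) {g : ℕ → ℝ} {C : ℝ} (hg : ∀ m, |g m| ≤ C) :
    Integrable (fun x => reciprocalTime β n x * g (infoTime β n x)) μ :=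
  integrable_of_measurable_of_norm_le ((measurable_reciprocalTime β n).mul
    ((measurable_from_nat (f := g)).comp (measurable_infoTime β n))) (C := 1 * C) fun x => by
      rw [norm_mul, Real.norm_eq_abs, Real.norm_eq_abs,
        abs_of_nonneg (reciprocalTime_nonneg β n x)]
      exact mul_le_mul (reciprocalTime_le_one β n x) (hg _) (abs_nonneg _) zero_le_one

theorem abs_card_leaves_filter_le (p : ℕ → ℕ) (n : ℕ) (r : ℕ → Prop) [DecidablePred r] :
    |(((leaves p n).filter r).card : ℝ)| ≤ n := by
  rw [abs_of_nonneg (Nat.cast_nonneg _)]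
  exact_mod_cast (Finset.card_filter_le _ _).trans (degreeCount_le p 1 n)

/-- For an integer label, exceeding `n - n ^ β * x` is the same as exceeding its floor. Exchanging
sum and integral thus turns the drift into an average of the number of leaves too young to be
visible. -/
theorem drift_eq (α : ℝ) (p : ℕ → ℕ) (n : ℕ) :
    drift α β μ p n = 1 + gam α * ∫ x, reciprocalTime β n x *
        (((leaves p n).filter (¬ · ≤ infoTime β n x)).card : ℝ) ∂μ
      - if deg p 1 n = 1 then truncProb β μ n else 0 := by
  have h : ∀ i : ℕ, ∀ x : ℝ, {x : ℝ | 1 ≤ (n : ℝ) - (n : ℝ) ^ β * x ∧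
      (n : ℝ) - (n : ℝ) ^ β * x < (i : ℝ)}.indicator (fun x => 1 / (infoTime β n x : ℝ)) x
      = reciprocalTime β n x * if ¬ i ≤ infoTime β n x then 1 else 0 := by
    intro i x
    by_cases h1 : x ∈ untruncated β n
    · have h2 := le_infoTime_iff h1 i
      by_cases h3 : i ≤ infoTime β n x
      · rw [Set.indicator_of_notMem (fun h4 => not_lt.2 (h2.1 h3) h4.2)]
        simp [h3]
      · have h4 : (n : ℝ) - (n : ℝ) ^ β * x < i := not_le.1 fun h5 => h3 (h2.2 h5)
        refine (Set.indicator_of_mem (show x ∈ {y : ℝ | 1 ≤ (n : ℝ) - (n : ℝ) ^ β * y ∧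
          (n : ℝ) - (n : ℝ) ^ β * y < (i : ℝ)} from ⟨h1, h4⟩) _).trans ?_
        rw [reciprocalTime, Set.indicator_of_mem h1]
        simp [h3]
    · rw [Set.indicator_of_notMem (fun h4 => h1 h4.1), reciprocalTime,
        Set.indicator_of_notMem h1, zero_mul]
  unfold drift
  rw [truncProb, compl_untruncated]
  congr 3
  change ∑ i ∈ leaves p n, _ = _
  simp_rw [h]
  rw [← integral_finsetSum]
  · congr 1; ext x
    rw [← Finset.mul_sum, Finset.card_filter]
    push_cast; rfl
  · intro i _
    refine integrable_reciprocalTime_mul n (g := fun m => if ¬ i ≤ m then 1 else 0) (C := 1) ?_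
    intro m; split_ifs <;> simp

/-- At most `n - m < n ^ β * x + 1` labels lie beyond the visible time `m`, whatever the tree; this
uniformity makes the strong law deterministic. -/
theorem abs_drift_sub_one_le (hα : -1 < α) (hμ : ∀ᵐ x ∂μ, 0 ≤ x) (p : ℕ → ℕ) {n : ℕ}
    (hn : 1 ≤ n) :
    |drift α β μ p n - 1| ≤ delayCost β μ n + meanReciprocal β μ n + truncProb β μ n := by
  set I := ∫ x, reciprocalTime β n x *
        (((leaves p n).filter (¬ · ≤ infoTime β n x)).card : ℝ) ∂μ with hI
  have hI0 : 0 ≤ I := integral_nonneg fun x =>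
    mul_nonneg (reciprocalTime_nonneg β n x) (Nat.cast_nonneg _)
  have i1 := integrable_delayCostFun (β := β) hμ n
  have i2 := integrable_reciprocalTime (β := β) (μ := μ) n
  have hI1 : I ≤ delayCost β μ n + meanReciprocal β μ n := by
    change _ ≤ (∫ x, delayCostFun β n x ∂μ) + _
    rw [meanReciprocal, ← integral_add i1 i2]
    refine integral_mono_ae (integrable_reciprocalTime_mul n
      (g := fun m => (((leaves p n).filter (¬ · ≤ m)).card : ℝ))
      fun m => abs_card_leaves_filter_le p n _) (i1.add i2) ?_
    filter_upwards [hμ] with x hx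
    by_cases h : x ∈ untruncated β n
    · have hm := infoTime_le (β := β) hn hx
      have hcard : ((leaves p n).filter (¬ · ≤ infoTime β n x)).card ≤ n - infoTime β n x := by
        calc _ ≤ (Finset.Ioc (infoTime β n x) n).card := Finset.card_le_card fun v hv => by
              rw [leaves, Finset.mem_filter, Finset.mem_filter, Finset.mem_Icc] at hv
              exact Finset.mem_Ioc.2 ⟨not_le.1 hv.2, hv.1.1.2⟩
          _ = _ := by simp
      have hcard' : (((leaves p n).filter (¬ · ≤ infoTime β n x)).card : ℝ)
          ≤ n - infoTime β n x := by
        rw [← Nat.cast_sub hm]; exact_mod_cast hcard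
      have h1 := sub_lt_infoTime_add_one h
      have h0 : (0 : ℝ) < infoTime β n x := by exact_mod_cast one_le_infoTime β n x
      simp only [reciprocalTime, delayCostFun, Set.indicator_of_mem h]
      rw [← add_div, one_div_mul_eq_div]
      gcongr
      linarith
    · simp [reciprocalTime, delayCostFun, Set.indicator_of_notMem h]
  have hT := truncProb_nonneg (β := β) (μ := μ) n
  have hg0 := (gam_pos hα).le
  have h1 : gam α * I ≤ I := mul_le_of_le_one_left hI0 (gam_le_one hα)
  have h2 : 0 ≤ gam α * I := mul_nonneg hg0 hI0
  rw [drift_eq, ← hI, abs_le]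
  constructor <;> split_ifs <;> linarith

/-- The mean increment of the number of leaves is an affine function of this number, up to an
error of the order of the reciprocal of the visible time. -/
theorem IsParentSequence.abs_drift_error_le (hp : IsParentSequence p) (hα : -1 < α)
    (hμ : ∀ᵐ x ∂μ, 0 ≤ x) {n : ℕ} (hn : 1 ≤ n) :
    |(1 - contraction α β μ n) * degreeCount p 1 n + 1 - leafAttachProb α β μ p n
      - drift α β μ p n| ≤ 2 * meanReciprocal β μ n := by
  set c : ℕ → ℝ := fun m => (((leaves p n).filter (· ≤ m)).card : ℝ) with hc
  set d : ℕ → ℝ := fun m => (((leaves p n).filter (¬ · ≤ m)).card : ℝ) with hd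
  set δ : ℝ := if deg p 1 n = 1 then 1 else 0 with hδ
  have hcd : ∀ m, (degreeCount p 1 n : ℝ) = c m + d m := fun m => by
    rw [← card_leaves, ← Finset.card_filter_add_card_filter_not (s := leaves p n) (· ≤ m)]
    push_cast; rfl
  have i1 := integrable_reciprocalTime (β := β) (μ := μ) n
  have ic : Integrable (fun x => reciprocalTime β n x * c (infoTime β n x)) μ :=
    integrable_reciprocalTime_mul n fun m => abs_card_leaves_filter_le p n _
  have id : Integrable (fun x => reciprocalTime β n x * d (infoTime β n x)) μ :=
    integrable_reciprocalTime_mul n fun m => abs_card_leaves_filter_le p n _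
  have iq := hp.integrable_sum_attachProb (β := β) (μ := μ) hα n (leaves p n)
  have iT : Integrable ((untruncated β n)ᶜ.indicator (1 : ℝ → ℝ)) μ :=
    (integrable_const (1 : ℝ)).indicator (measurableSet_untruncated β n).compl
  have e1 : (∫ x, reciprocalTime β n x * c (infoTime β n x) ∂μ)
      + ∫ x, reciprocalTime β n x * d (infoTime β n x) ∂μ
      = meanReciprocal β μ n * degreeCount p 1 n := by
    rw [← integral_add ic id, meanReciprocal, ← integral_mul_const]
    congr 1; ext x
    rw [hcd (infoTime β n x)]; ring
  have e2 : (if deg p 1 n = 1 then truncProb β μ n else 0)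
      = δ * ∫ x, (untruncated β n)ᶜ.indicator (1 : ℝ → ℝ) x ∂μ := by
    rw [integral_indicator_one (measurableSet_untruncated β n).compl, hδ, truncProb]
    split_ifs <;> simp
  have e3 : (1 - contraction α β μ n) * degreeCount p 1 n + 1 - leafAttachProb α β μ p n
      - drift α β μ p n = ∫ x, (gam α * (reciprocalTime β n x * c (infoTime β n x))
        + δ * (untruncated β n)ᶜ.indicator (1 : ℝ → ℝ) x
        - ∑ v ∈ leaves p n, attachProb (affine α) p (infoTime β n x) v) ∂μ := by
    have i2 : Integrable (fun x => gam α * (reciprocalTime β n x * c (infoTime β n x))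
        + δ * (untruncated β n)ᶜ.indicator (1 : ℝ → ℝ) x) μ :=
      (ic.const_mul _).add (iT.const_mul _)
    rw [integral_sub i2 iq, integral_add (ic.const_mul _) (iT.const_mul _), integral_const_mul,
      integral_const_mul, ← e2, drift_eq, contraction_eq, leafAttachProb]
    have e4 : (1 - (1 - gam α * meanReciprocal β μ n)) * (degreeCount p 1 n : ℝ)
        = gam α * (meanReciprocal β μ n * degreeCount p 1 n) := by ring
    rw [e4, ← e1]
    ring
  rw [e3, meanReciprocal, ← integral_const_mul, ← Real.norm_eq_abs]
  refine norm_integral_le_of_norm_le (i1.const_mul 2) ?_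
  filter_upwards [hμ] with x hx
  have hm1 := one_le_infoTime β n x
  rw [hp.sum_leaves_attachProb α hm1 (infoTime_le hn hx), Real.norm_eq_abs]
  change |_ - c (infoTime β n x) * _| ≤ _
  -- Without truncation the integrand is `c m / m ≤ 1` times the discrepancy in `abs_gam_sub_le`.
  -- With truncation only the root is visible, a leaf is hit with probability exactly `δ`, and the
  -- truncation term of the drift cancels this.
  by_cases h : x ∈ untruncated β n
  · set m := infoTime β n x with hm
    have hm0 : (0 : ℝ) < m := by exact_mod_cast hm1
    have hcm : c m ≤ m := Nat.cast_le.2 (card_leaves_filter_le p n m)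
    have hc0 : 0 ≤ c m := Nat.cast_nonneg _
    rw [Set.indicator_of_notMem (Set.notMem_compl_iff.2 h), mul_zero, add_zero, reciprocalTime,
      Set.indicator_of_mem h, ← hm]
    have e5 : gam α * (1 / (m : ℝ) * c m) - c m * ((1 + α) / totalWeight α m)
        = c m / m * (gam α - m * ((1 + α) / totalWeight α m)) := by
      field_simp
    rw [e5, abs_mul, abs_of_nonneg (div_nonneg hc0 hm0.le), mul_one_div]
    calc _ ≤ 1 * (2 / (m : ℝ)) := mul_le_mul ((div_le_one hm0).2 hcm) (abs_gam_sub_le hα hm1)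
          (abs_nonneg _) zero_le_one
      _ = _ := one_mul _
  · have h1 : infoTime β n x = 1 := infoTime_eq_one (not_le.1 h)
    have h2 : c 1 = δ := by
      rw [hc, hδ]
      simp only
      rw [card_leaves_filter_le_one p hn]
      push_cast; rfl
    have h3 : 1 + α ≠ 0 := by linarith
    rw [Set.indicator_of_mem (Set.mem_compl h), reciprocalTime, Set.indicator_of_notMem h, h1, h2,
      totalWeight, if_pos rfl, div_self h3]
    simp

end

/-! ### Functions of the tree at a given time -/

/-- The parent sequence obtained by joining to the root all vertices whose parent is not earlier. -/
def clipParent (p : ℕ → ℕ) (j : ℕ) : ℕ := if 1 ≤ p j ∧ p j < j then p j else 1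

theorem isParentSequence_clipParent (p : ℕ → ℕ) : IsParentSequence (clipParent p) := by
  intro j hj
  unfold clipParent
  split_ifs with h
  · exact h
  · omega

theorem IsParentSequence.clipParent_eq {p : ℕ → ℕ} (hp : IsParentSequence p) {j : ℕ}
    (hj : 2 ≤ j) : clipParent p j = p j := if_pos (hp j hj)

/-- `F` is a function of the tree at time `n`. -/
def IsTreeFunction {X : Type*} (n : ℕ) (F : (ℕ → ℕ) → X) : Prop :=
  ∀ p p' : ℕ → ℕ, (∀ j, 2 ≤ j → j ≤ n → p j = p' j) → F p = F p'

namespace IsTreeFunction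

variable {X : Type*} {n : ℕ} {F : (ℕ → ℕ) → X}

theorem mono (h : IsTreeFunction n F) {m : ℕ} (hnm : n ≤ m) : IsTreeFunction m F :=
  fun p p' hpp => h p p' fun j h2 hj => hpp j h2 (hj.trans hnm)

theorem clip (h : IsTreeFunction n F) : IsTreeFunction n fun p => F (clipParent p) :=
  fun p p' hpp => h _ _ fun j h2 hj => by simp only [clipParent, hpp j h2 hj]

/-- The random parents form a valid sequence only almost surely. Clipping makes the bounds required
by `CompensatedRecursion` hold at every sample point, and changes nothing on valid sequences. -/
theorem comp_clipParent (h : IsTreeFunction n F) {p : ℕ → ℕ} (hp : IsParentSequence p) :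
    F (clipParent p) = F p :=
  h _ _ fun _ h2 _ => hp.clipParent_eq h2

end IsTreeFunction

/-- A parent sequence with given parents up to time `n`. -/
def extendTree {n : ℕ} (T : Finset.Icc 2 n → ℕ) (j : ℕ) : ℕ :=
  if h : j ∈ Finset.Icc 2 n then T ⟨j, h⟩ else 0

theorem extendTree_treeAt {Ω : Type*} (par : ℕ → Ω → ℕ) (n : ℕ) (ω : Ω) {j : ℕ} (h2 : 2 ≤ j)
    (hj : j ≤ n) : extendTree (treeAt par n ω) j = par j ω :=
  dif_pos (Finset.mem_Icc.2 ⟨h2, hj⟩)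

/-- The `σ`-algebra generated by the tree at time `n`. -/
@[reducible]
def treeSigma {Ω : Type*} (par : ℕ → Ω → ℕ) (n : ℕ) : MeasurableSpace Ω :=
  MeasurableSpace.comap (treeAt par n) inferInstance

/-- The tree at time `n` takes values in a countable discrete space, so measurability is only a
matter of factoring through it. -/
theorem IsTreeFunction.measurable {Ω X : Type*} [MeasurableSpace X] {n : ℕ} {F : (ℕ → ℕ) → X}
    (h : IsTreeFunction n F) (par : ℕ → Ω → ℕ) :
    Measurable[treeSigma par n] fun ω => F fun j => par j ω := by
  have e : (fun ω => F fun j => par j ω) = (fun T => F (extendTree T)) ∘ treeAt par n := by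
    ext ω
    exact h _ _ fun j h2 hj => (extendTree_treeAt par n ω h2 hj).symm
  rw [e]
  exact (Measurable.of_discrete (f := fun T : Finset.Icc 2 n → ℕ => F (extendTree T))).comp
    (comap_measurable _)

theorem isTreeFunction_deg (v n : ℕ) : IsTreeFunction n fun p => deg p v n := by
  intro p p' h
  have h1 : inDegree p v n = inDegree p' v n := by
    unfold inDegree
    congr 1
    refine Finset.filter_congr fun j hj => ?_
    rw [Finset.mem_Icc] at hj
    rw [h j hj.1 hj.2]
  simp only [deg, h1]

theorem isTreeFunction_leaves (n : ℕ) : IsTreeFunction n fun p => leaves p n := by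
  intro p p' h
  exact Finset.filter_congr fun v _ => by
    rw [show deg p v n = deg p' v n from isTreeFunction_deg v n p p' h]

theorem isTreeFunction_degreeCount (n : ℕ) : IsTreeFunction n fun p => degreeCount p 1 n := by
  intro p p' h
  simp only [← card_leaves]
  rw [show leaves p n = leaves p' n from isTreeFunction_leaves n p p' h]

theorem isTreeFunction_attachProb (f : ℕ → ℝ) {m n : ℕ} (hmn : m ≤ n) (v : ℕ) :
    IsTreeFunction n fun p => attachProb f p m v := by
  intro p p' h
  have h1 : ∀ u, deg p u m = deg p' u m := fun u => (isTreeFunction_deg u m).mono hmn p p' h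
  simp only [attachProb, h1]

theorem isTreeFunction_drift (α β : ℝ) (μ : Measure ℝ) [IsProbabilityMeasure μ] (n : ℕ) :
    IsTreeFunction n fun p => drift α β μ p n := by
  intro p p' h
  simp only [drift_eq]
  rw [show leaves p n = leaves p' n from isTreeFunction_leaves n p p' h,
    show deg p 1 n = deg p' 1 n from isTreeFunction_deg 1 n p p' h]

theorem isTreeFunction_centering (α β : ℝ) (μ : Measure ℝ) [IsProbabilityMeasure μ] (n : ℕ) :
    IsTreeFunction n fun p => centering α β μ p n := by
  intro p p' h
  refine Finset.sum_congr rfl fun i hi => ?_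
  congr 1
  exact (isTreeFunction_drift α β μ i).mono (Finset.mem_Ico.1 hi).2.le p p' h

theorem isTreeFunction_leafAttachProb (α : ℝ) {β : ℝ} {μ : Measure ℝ} (hμ : ∀ᵐ x ∂μ, 0 ≤ x)
    {n : ℕ} (hn : 1 ≤ n) : IsTreeFunction n fun p => leafAttachProb α β μ p n := by
  intro p p' h
  simp only [leafAttachProb]
  rw [show leaves p n = leaves p' n from isTreeFunction_leaves n p p' h]
  refine integral_congr_ae ?_
  filter_upwards [hμ] with x hx
  exact Finset.sum_congr rfl fun v _ => isTreeFunction_attachProb _ (infoTime_le hn hx) v p p' h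

/-! ### The conditional law of the parent of a new vertex -/

theorem integral_mul_eq_of_condExp_ae_eq {Ω : Type*} {m mΩ : MeasurableSpace Ω} {P : Measure Ω}
    [IsFiniteMeasure P] (hm : m ≤ mΩ) {g u A : Ω → ℝ} (hg : Measurable[m] g) {C : ℝ}
    (hC : ∀ ω, |g ω| ≤ C) (hu : Integrable u P) (hA : P[u|m] =ᵐ[P] A) :
    ∫ ω, g ω * u ω ∂P = ∫ ω, g ω * A ω ∂P := by
  have hg' : Measurable g := hg.mono hm le_rfl
  have igu : Integrable (g * u) P := hu.bdd_mul hg'.aestronglyMeasurable (ae_of_all _ hC)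
  have h1 := condExp_mul_of_stronglyMeasurable_left hg.stronglyMeasurable igu hu
  change ∫ ω, (g * u) ω ∂P = _
  rw [← integral_condExp hm]
  refine integral_congr_ae ?_
  filter_upwards [h1, hA] with ω h2 h3
  rw [h2, Pi.mul_apply, h3]

namespace IsDelayedNetwork

variable {Ω : Type*} [MeasurableSpace Ω] {P : Measure Ω} {β : ℝ} {μ : Measure ℝ} {f : ℕ → ℝ}
  {ξ : ℕ → Ω → ℝ} {par : ℕ → Ω → ℕ}

theorem measurable_treeAt (hnet : IsDelayedNetwork P β μ f ξ par) (n : ℕ) :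
    Measurable (treeAt par n) :=
  measurable_pi_lambda _ fun j => hnet.measurable_parent j

theorem treeSigma_le (hnet : IsDelayedNetwork P β μ f ξ par) (n : ℕ) :
    treeSigma par n ≤ ‹MeasurableSpace Ω› :=
  (hnet.measurable_treeAt n).comap_le

theorem ae_delay_nonneg (hnet : IsDelayedNetwork P β μ f ξ par) (hμ : ∀ᵐ x ∂μ, 0 ≤ x) {n : ℕ}
    (hn : 2 ≤ n) : ∀ᵐ ω ∂P, 0 ≤ ξ (n + 1) ω := by
  rw [← hnet.delay_law n hn] at hμ
  exact ae_of_ae_map (hnet.measurable_delay _).aemeasurable hμ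

variable [IsProbabilityMeasure P] [IsProbabilityMeasure μ]

/-- The attachment rule conditions on tree and delay jointly. By independence their joint law is a
product, and Fubini integrates the delay out, leaving the conditional probability given the tree
alone. -/
theorem integral_mul_indicator (hnet : IsDelayedNetwork P β μ f ξ par) (hμ : ∀ᵐ x ∂μ, 0 ≤ x)
    {n : ℕ} (hn : 2 ≤ n) (v : ℕ) {g : Ω → ℝ} (hg : Measurable[treeSigma par n] g) {C : ℝ}
    (hC : ∀ ω, |g ω| ≤ C) :
    ∫ ω, g ω * {ω | par (n + 1) ω = v}.indicator (fun _ => (1 : ℝ)) ω ∂P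
      = ∫ ω, g ω * ∫ x, attachProb f (fun j => par j ω) (infoTime β n x) v ∂μ ∂P := by
  have hT := hnet.measurable_treeAt n
  have hξ := hnet.measurable_delay (n + 1)
  have hsub : treeSigma par n
      ≤ MeasurableSpace.comap (fun ω => (treeAt par n ω, ξ (n + 1) ω)) inferInstance := by
    rw [← measurable_iff_comap_le]
    exact measurable_fst.comp (comap_measurable _)
  have hg' : Measurable g := hg.mono (hnet.treeSigma_le n) le_rfl
  have hattach := hnet.attach n hn v
  set A : Ω → ℝ := fun ω => attachProb f (fun j => par j ω) (infoTime β n (ξ (n + 1) ω)) v with hA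
  have iA : Integrable A P := integrable_condExp.congr hattach
  have e1 := integral_mul_eq_of_condExp_ae_eq (hT.prodMk hξ).comap_le (hg.mono hsub le_rfl) hC
    ((integrable_const (1 : ℝ)).indicator (show MeasurableSet {ω | par (n + 1) ω = v} from
      hnet.measurable_parent (n + 1) (measurableSet_singleton v))) hattach
  obtain ⟨G, hG, rfl⟩ := Measurable.exists_eq_measurable_comp hg
  set Φ : ℝ × (Finset.Icc 2 n → ℕ) → ℝ :=
    fun z => G z.2 * attachProb f (extendTree z.2) (infoTime β n z.1) v with hΦ
  have mΦ : Measurable Φ := by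
    refine measurable_from_prod_countable_left fun T => ?_
    exact ((measurable_from_nat (f := fun k => attachProb f (extendTree T) k v)).comp
      (measurable_infoTime β n)).const_mul (G T)
  have hΦeq : (fun ω => Φ (ξ (n + 1) ω, treeAt par n ω))
      -- Nonnegative delays keep the visible time at most `n`, so only parents recorded in the tree
      -- at time `n` matter.
      =ᵐ[P] fun ω => (G ∘ treeAt par n) ω * A ω := by
    filter_upwards [hnet.ae_delay_nonneg hμ hn] with ω hω
    simp only [hΦ, hA, Function.comp_apply]
    congr 1
    exact isTreeFunction_attachProb f (infoTime_le (by omega) hω) v _ _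
      fun j h2 hj => extendTree_treeAt par n ω h2 hj
  have iΦ : Integrable (fun ω => Φ (ξ (n + 1) ω, treeAt par n ω)) P :=
    (iA.bdd_mul hg'.aestronglyMeasurable (ae_of_all _ hC)).congr hΦeq.symm
  have hmap : P.map (fun ω => (ξ (n + 1) ω, treeAt par n ω)) = μ.prod (P.map (treeAt par n)) := by
    rw [(indepFun_iff_map_prod_eq_prod_map_map hξ.aemeasurable hT.aemeasurable).1
      (hnet.delay_indep n hn), hnet.delay_law n hn]
  have : IsProbabilityMeasure (P.map (treeAt par n)) :=
    Measure.isProbabilityMeasure_map hT.aemeasurable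
  have iΦ' : Integrable Φ (μ.prod (P.map (treeAt par n))) := by
    rw [← hmap, integrable_map_measure mΦ.aestronglyMeasurable (hξ.prodMk hT).aemeasurable]
    exact iΦ
  rw [e1, ← integral_congr_ae hΦeq,
    ← integral_map (hξ.prodMk hT).aemeasurable mΦ.aestronglyMeasurable (f := Φ), hmap,
    integral_prod_symm _ iΦ', integral_map hT.aemeasurable
      (Measurable.of_discrete).aestronglyMeasurable]
  congr 1; ext ω
  simp only [hΦ, Function.comp_apply]
  rw [integral_const_mul]
  congr 1
  refine integral_congr_ae ?_
  filter_upwards [hμ] with x hx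
  exact isTreeFunction_attachProb f (infoTime_le (by omega) hx) v _ _
      fun j h2 hj => extendTree_treeAt par n ω h2 hj

theorem ae_parent_mem (hnet : IsDelayedNetwork P β μ f ξ par) (hμ : ∀ᵐ x ∂μ, 0 ≤ x) {n : ℕ}
    (hn : 2 ≤ n) : ∀ᵐ ω ∂P, par (n + 1) ω ∈ Finset.Icc 1 n := by
  have h : ∀ v, v ∉ Finset.Icc 1 n → ∀ᵐ ω ∂P, par (n + 1) ω ≠ v := by
    intro v hv
    have hSm : MeasurableSet {ω | par (n + 1) ω = v} :=
      hnet.measurable_parent (n + 1) (measurableSet_singleton v)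
    have h1 := hnet.integral_mul_indicator hμ hn v (g := fun _ => 1) measurable_const (C := 1)
      (by simp)
    have h2 : ∀ ω, ∫ x, attachProb f (fun j => par j ω) (infoTime β n x) v ∂μ = 0 := by
      intro ω
      refine integral_eq_zero_of_ae ?_
      filter_upwards [hμ] with x hx
      refine if_neg fun h3 => hv ?_
      rw [Finset.mem_Icc] at h3 ⊢
      exact ⟨h3.1, h3.2.trans (infoTime_le (by omega) hx)⟩
    simp only [h2, mul_zero, integral_zero, one_mul] at h1
    rw [integral_indicator_const _ hSm, smul_eq_mul, mul_one, measureReal_eq_zero_iff] at h1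
    exact measure_eq_zero_iff_ae_notMem.1 h1
  have h' : ∀ᵐ ω ∂P, ∀ v, v ∉ Finset.Icc 1 n → par (n + 1) ω ≠ v := by
    rw [ae_all_iff]
    intro v
    by_cases hv : v ∈ Finset.Icc 1 n
    · exact ae_of_all _ fun ω h => absurd hv h
    · filter_upwards [h v hv] with ω hω _ using hω
  filter_upwards [h'] with ω hω
  by_contra hcon
  exact hω _ hcon rfl

theorem ae_isParentSequence (hnet : IsDelayedNetwork P β μ f ξ par) (hμ : ∀ᵐ x ∂μ, 0 ≤ x) :
    ∀ᵐ ω ∂P, IsParentSequence fun j => par j ω := by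
  have h : ∀ᵐ ω ∂P, ∀ n, 2 ≤ n → par (n + 1) ω ∈ Finset.Icc 1 n := by
    rw [ae_all_iff]
    intro n
    by_cases hn : 2 ≤ n
    · filter_upwards [hnet.ae_parent_mem hμ hn] with ω hω _ using hω
    · exact ae_of_all _ fun ω h => absurd h hn
  filter_upwards [h, hnet.parent_two] with ω hω h2 j hj
  rcases hj.eq_or_lt with rfl | hj
  · simp only [h2]; omega
  · obtain ⟨n, rfl⟩ : ∃ n, j = n + 1 := ⟨j - 1, by omega⟩
    have := Finset.mem_Icc.1 (hω n (by omega))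
    simp only
    omega

end IsDelayedNetwork

/-! ### The compensated number of leaves -/

/-- The indicator that vertex `n + 1` is attached to a leaf, for `n ≥ 2`. -/
noncomputable def leafHit (p : ℕ → ℕ) (n : ℕ) : ℝ :=
  if n < 2 then 0 else if deg p (p (n + 1)) n = 1 then 1 else 0

/-- The conditional probability of `leafHit`. -/
noncomputable def leafHitProb (α β : ℝ) (μ : Measure ℝ) (p : ℕ → ℕ) (n : ℕ) : ℝ :=
  if n < 2 then 0 else leafAttachProb α β μ p n

/-- The contracted sum of the compensated attachments to leaves. -/
noncomputable def compensatedHits (α β : ℝ) (μ : Measure ℝ) (p : ℕ → ℕ) : ℕ → ℝ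
  | 0 => 0
  | n + 1 => contraction α β μ n * compensatedHits α β μ p n + (leafHitProb α β μ p n - leafHit p n)

theorem isTreeFunction_leafHit (n : ℕ) : IsTreeFunction (n + 1) fun p => leafHit p n := by
  intro p p' h
  by_cases hn : n < 2
  · simp only [leafHit, if_pos hn]
  · simp only [leafHit, h (n + 1) (by omega) le_rfl]
    rw [show deg p (p' (n + 1)) n = deg p' (p' (n + 1)) n from
      (isTreeFunction_deg _ n).mono n.le_succ p p' h]

theorem isTreeFunction_leafHitProb (α : ℝ) {β : ℝ} {μ : Measure ℝ} (hμ : ∀ᵐ x ∂μ, 0 ≤ x) (n : ℕ) :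
    IsTreeFunction n fun p => leafHitProb α β μ p n := by
  intro p p' h
  by_cases hn : n < 2
  · simp only [leafHitProb, if_pos hn]
  · simp only [leafHitProb]
    rw [show leafAttachProb α β μ p n = leafAttachProb α β μ p' n from
      isTreeFunction_leafAttachProb α hμ (by omega) p p' h]

theorem isTreeFunction_compensatedHits (α : ℝ) {β : ℝ} {μ : Measure ℝ} (hμ : ∀ᵐ x ∂μ, 0 ≤ x)
    (n : ℕ) : IsTreeFunction n fun p => compensatedHits α β μ p n := by
  induction n with
  | zero => intro p p' _; rfl
  | succ n ih =>
    intro p p' h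
    simp only [compensatedHits]
    rw [show compensatedHits α β μ p n = _ from ih.mono n.le_succ p p' h,
      show leafHit p n = _ from isTreeFunction_leafHit n p p' h,
      show leafHitProb α β μ p n = _ from
        (isTreeFunction_leafHitProb α hμ n).mono n.le_succ p p' h]

theorem leafHit_eq_zero_or_one (p : ℕ → ℕ) (n : ℕ) : leafHit p n = 0 ∨ leafHit p n = 1 := by
  unfold leafHit
  split_ifs <;> simp

theorem leafHit_eq_sum {p : ℕ → ℕ} {n : ℕ} (hn : 2 ≤ n) (h : p (n + 1) ∈ Finset.Icc 1 n) :
    leafHit p n = ∑ v ∈ Finset.Icc 1 n,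
      (if v ∈ leaves p n then (1 : ℝ) else 0) * if p (n + 1) = v then 1 else 0 := by
  simp only [mul_ite, mul_one, mul_zero]
  rw [Finset.sum_ite_eq, if_pos h, leafHit, if_neg (by omega), leaves]
  simp only [Finset.mem_filter, h, true_and]

/-- Attachments to leaves have the conditional probabilities `leafHitProb`. -/
theorem IsDelayedNetwork.integral_mul_leafHit {Ω : Type*} [MeasurableSpace Ω] {P : Measure Ω}
    [IsProbabilityMeasure P] {α β : ℝ} {μ : Measure ℝ} [IsProbabilityMeasure μ]
    {ξ : ℕ → Ω → ℝ} {par : ℕ → Ω → ℕ} (hnet : IsDelayedNetwork P β μ (affine α) ξ par)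
    (hα : -1 < α) (hμ : ∀ᵐ x ∂μ, 0 ≤ x) (n : ℕ) {g : Ω → ℝ} (hg : Measurable[treeSigma par n] g)
    {C : ℝ} (hC : ∀ ω, |g ω| ≤ C) :
    ∫ ω, g ω * leafHit (clipParent fun j => par j ω) n ∂P
      = ∫ ω, g ω * leafHitProb α β μ (clipParent fun j => par j ω) n ∂P := by
  by_cases hn : n < 2
  · simp [leafHit, leafHitProb, hn]
  rw [not_lt] at hn
  have hg' : Measurable g := hg.mono (hnet.treeSigma_le n) le_rfl
  -- Being a leaf is determined by the tree, so `g * δ v` is an admissible test function for each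
  -- single target `v`; the claim is the sum over `v`.
  set δ : ℕ → Ω → ℝ := fun v ω => if v ∈ leaves (fun j => par j ω) n then 1 else 0 with hδ
  have hδt : ∀ v, Measurable[treeSigma par n] (δ v) := fun v =>
    IsTreeFunction.measurable (F := fun p => if v ∈ leaves p n then (1 : ℝ) else 0)
      (fun p p' h => by
        simp only [show leaves p n = leaves p' n from isTreeFunction_leaves n p p' h]) par
  have hδ1 : ∀ v ω, |δ v ω| ≤ 1 := fun v ω => by
    simp only [hδ]; split_ifs <;> simp
  have hgδ : ∀ v, Measurable[treeSigma par n] fun ω => g ω * δ v ω := fun v => hg.mul (hδt v)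
  have hgδC : ∀ v ω, |g ω * δ v ω| ≤ C := fun v ω => by
    rw [abs_mul]
    exact (mul_le_of_le_one_right (abs_nonneg _) (hδ1 v ω)).trans (hC ω)
  have hgδ' : ∀ v, Integrable (fun ω => g ω * δ v ω) P := fun v =>
    integrable_of_measurable_of_norm_le ((hgδ v).mono (hnet.treeSigma_le n) le_rfl) (hgδC v)
  set ind : ℕ → Ω → ℝ := fun v => {ω | par (n + 1) ω = v}.indicator (fun _ => (1 : ℝ)) with hind
  have iind : ∀ v, Integrable (fun ω => g ω * δ v ω * ind v ω) P := fun v => by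
    have h1 : Integrable (ind v) P := (integrable_const (1 : ℝ)).indicator
      (show MeasurableSet {ω | par (n + 1) ω = v} from
        hnet.measurable_parent (n + 1) (measurableSet_singleton v))
    exact h1.bdd_mul (hgδ' v).aestronglyMeasurable (ae_of_all _ (hgδC v))
  set Q : ℕ → Ω → ℝ := fun v ω =>
    ∫ x, attachProb (affine α) (fun j => par j ω) (infoTime β n x) v ∂μ with hQ
  have hval := hnet.ae_isParentSequence hμ
  have iattach : ∀ p, IsParentSequence p → ∀ v,
      Integrable (fun x => attachProb (affine α) p (infoTime β n x) v) μ := fun p hp v => by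
    simpa using hp.integrable_sum_attachProb (β := β) (μ := μ) hα n {v}
  have hQt : ∀ v, Measurable[treeSigma par n] (Q v) := fun v =>
    IsTreeFunction.measurable
      (F := fun p => ∫ x, attachProb (affine α) p (infoTime β n x) v ∂μ) (fun p p' h => by
        refine integral_congr_ae ?_
        filter_upwards [hμ] with x hx
        exact isTreeFunction_attachProb _ (infoTime_le (by omega) hx) v p p' h) par
  have iQ : ∀ v, Integrable (fun ω => g ω * δ v ω * Q v ω) P := fun v => by
    have h1 : Integrable (Q v) P := by
      refine Integrable.of_bound
        ((hQt v).mono (hnet.treeSigma_le n) le_rfl).aestronglyMeasurable 1 ?_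
      filter_upwards [hval] with ω hω
      rw [Real.norm_eq_abs, abs_of_nonneg (integral_nonneg fun x => hω.attachProb_nonneg hα _ v)]
      calc Q v ω ≤ ∫ _, (1 : ℝ) ∂μ := integral_mono (iattach _ hω v) (integrable_const _)
            fun x => by simpa using hω.sum_attachProb_le_one hα (infoTime β n x) {v}
        _ = 1 := by simp
    exact h1.bdd_mul (hgδ' v).aestronglyMeasurable (ae_of_all _ (hgδC v))
  have e1 : ∫ ω, g ω * leafHit (clipParent fun j => par j ω) n ∂P
      = ∫ ω, ∑ v ∈ Finset.Icc 1 n, g ω * δ v ω * ind v ω ∂P := by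
    refine integral_congr_ae ?_
    filter_upwards [hval] with ω hω
    have hmem : par (n + 1) ω ∈ Finset.Icc 1 n := by
      have : 1 ≤ par (n + 1) ω ∧ par (n + 1) ω < n + 1 := hω (n + 1) (by omega)
      rw [Finset.mem_Icc]; omega
    have h1 : leafHit (clipParent fun j => par j ω) n = leafHit (fun j => par j ω) n :=
      (isTreeFunction_leafHit n).comp_clipParent hω
    rw [h1, leafHit_eq_sum hn hmem, Finset.mul_sum]
    refine Finset.sum_congr rfl fun v _ => ?_
    rw [← mul_assoc]
    congr 1
    simp [hind, Set.indicator_apply]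
  have e2 : ∫ ω, g ω * leafHitProb α β μ (clipParent fun j => par j ω) n ∂P
      = ∫ ω, ∑ v ∈ Finset.Icc 1 n, g ω * δ v ω * Q v ω ∂P := by
    refine integral_congr_ae ?_
    filter_upwards [hval] with ω hω
    have h1 : leafHitProb α β μ (clipParent fun j => par j ω) n
        = leafHitProb α β μ (fun j => par j ω) n :=
      (isTreeFunction_leafHitProb α hμ n).comp_clipParent hω
    rw [h1, leafHitProb, if_neg (by omega), leafAttachProb,
      integral_finsetSum _ fun v _ => iattach _ hω v, leaves, Finset.sum_filter, Finset.mul_sum]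
    refine Finset.sum_congr rfl fun v hv => ?_
    simp only [hδ, hQ, leaves, Finset.mem_filter, hv, true_and]
    split_ifs <;> simp
  rw [e1, e2, integral_finsetSum _ fun v _ => iind v, integral_finsetSum _ fun v _ => iQ v]
  exact Finset.sum_congr rfl fun v _ => hnet.integral_mul_indicator hμ hn v (hgδ v) (hgδC v)

theorem IsDelayedNetwork.compensatedRecursion {Ω : Type*} [MeasurableSpace Ω] {P : Measure Ω}
    [IsProbabilityMeasure P] {α β : ℝ} {μ : Measure ℝ} [IsProbabilityMeasure μ]
    {ξ : ℕ → Ω → ℝ} {par : ℕ → Ω → ℕ} (hnet : IsDelayedNetwork P β μ (affine α) ξ par)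
    (hα : -1 < α) (hμ : ∀ᵐ x ∂μ, 0 ≤ x) :
    CompensatedRecursion P (treeSigma par) (contraction α β μ)
      (fun n ω => leafHitProb α β μ (clipParent fun j => par j ω) n)
      (fun n ω => leafHit (clipParent fun j => par j ω) n)
      (fun n ω => compensatedHits α β μ (clipParent fun j => par j ω) n) where
  le := hnet.treeSigma_le
  k_nonneg := contraction_nonneg hα
  k_le_one := contraction_le_one hα
  q_nonneg n ω := by
    unfold leafHitProb
    split_ifs
    · exact le_rfl
    · exact (isParentSequence_clipParent _).leafAttachProb_nonneg hα n
  q_le_one n ω := by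
    unfold leafHitProb
    split_ifs
    · exact zero_le_one
    · exact (isParentSequence_clipParent _).leafAttachProb_le_one hα n
  L_mem n ω := leafHit_eq_zero_or_one _ n
  U_zero ω := rfl
  U_succ n ω := rfl
  measurable_U n := (isTreeFunction_compensatedHits α hμ n).clip.measurable par
  measurable_q n := (isTreeFunction_leafHitProb α hμ n).clip.measurable par
  measurable_L n := ((isTreeFunction_leafHit n).clip.measurable par).mono
    (hnet.treeSigma_le _) le_rfl
  cond n g hg hC := by
    obtain ⟨C, hC⟩ := hC
    exact hnet.integral_mul_leafHit hα hμ n hg hC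

/-! ### Deterministic error bounds -/

/-- The total deviation of the delayed from the undelayed dynamics at time `n`. -/
noncomputable def delayError (β : ℝ) (μ : Measure ℝ) (n : ℕ) : ℝ :=
  delayCost β μ n + meanReciprocal β μ n + truncProb β μ n

/-- A bound for the distance of the number of leaves from its compensated centering. -/
noncomputable def remainderBound (β : ℝ) (μ : Measure ℝ) (n : ℕ) : ℝ :=
  3 + delayError β μ 1 + ∑ i ∈ Finset.range n, 2 * meanReciprocal β μ i

/-- A bound for the distance of the centering from its linear asymptote. -/
noncomputable def centeringBound (β : ℝ) (μ : Measure ℝ) (n : ℕ) : ℝ :=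
  1 + ∑ i ∈ Finset.range n, 2 * delayError β μ i

theorem centering_succ (α β : ℝ) (μ : Measure ℝ) (p : ℕ → ℕ) {n : ℕ} (hn : 1 ≤ n) :
    centering α β μ p (n + 1) = contraction α β μ n * centering α β μ p n + drift α β μ p n := by
  unfold centering
  rw [Finset.sum_Ico_succ_top hn, Finset.mul_sum]
  simp only [Finset.Ico_self, Finset.prod_empty, one_mul]
  congr 1
  refine Finset.sum_congr rfl fun i hi => ?_
  rw [Finset.prod_Ico_succ_top (Finset.mem_Ico.1 hi).2]
  ring

theorem delayError_nonneg {β : ℝ} {μ : Measure ℝ} (hμ : ∀ᵐ x ∂μ, 0 ≤ x) (n : ℕ) :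
    0 ≤ delayError β μ n :=
  add_nonneg (add_nonneg (delayCost_nonneg hμ n) (meanReciprocal_nonneg n)) (truncProb_nonneg n)

theorem remainderBound_nonneg {β : ℝ} {μ : Measure ℝ} (hμ : ∀ᵐ x ∂μ, 0 ≤ x) (n : ℕ) :
    0 ≤ remainderBound β μ n := by
  have h1 := delayError_nonneg (β := β) hμ 1
  have h2 : 0 ≤ ∑ i ∈ Finset.range n, 2 * meanReciprocal β μ i :=
    Finset.sum_nonneg fun i _ => mul_nonneg two_pos.le (meanReciprocal_nonneg i)
  unfold remainderBound
  linarith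

theorem centeringBound_nonneg {β : ℝ} {μ : Measure ℝ} (hμ : ∀ᵐ x ∂μ, 0 ≤ x) (n : ℕ) :
    0 ≤ centeringBound β μ n := by
  have h2 : 0 ≤ ∑ i ∈ Finset.range n, 2 * delayError β μ i :=
    Finset.sum_nonneg fun i _ => mul_nonneg two_pos.le (delayError_nonneg hμ i)
  unfold centeringBound
  linarith

theorem abs_centeringBound_succ_le {β : ℝ} {μ : Measure ℝ} (hμ : ∀ᵐ x ∂μ, 0 ≤ x) (n : ℕ) :
    |centeringBound β μ (n + 1)| ≤ |centeringBound β μ n| + 2 * delayError β μ n := by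
  rw [abs_of_nonneg (centeringBound_nonneg hμ _), abs_of_nonneg (centeringBound_nonneg hμ _),
    centeringBound, Finset.sum_range_succ, ← add_assoc]
  exact le_rfl

section

variable {α β : ℝ} {μ : Measure ℝ} [IsProbabilityMeasure μ]

/-- Subtracting the compensated hits removes all randomness of the new attachment: `leafHit` cancels
path by path. Only the drift errors accumulate, since the contraction factor lies in `[0, 1]`. -/
theorem IsParentSequence.abs_remainder_le {p : ℕ → ℕ} (hp : IsParentSequence p) (hα : -1 < α)
    (hμ : ∀ᵐ x ∂μ, 0 ≤ x) {n : ℕ} (hn : 2 ≤ n) :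
    |degreeCount p 1 n - centering α β μ p n - compensatedHits α β μ p n|
      ≤ remainderBound β μ n := by
  induction n, hn using Nat.le_induction with
  | base =>
    have h1 : compensatedHits α β μ p 2 = 0 := by
      simp [compensatedHits, leafHit, leafHitProb]
    have h2 : centering α β μ p 2 = drift α β μ p 1 := by
      rw [centering_succ α β μ p le_rfl]; simp [centering]
    have h3 := abs_drift_sub_one_le (β := β) (α := α) hα hμ p le_rfl
    have h4 : (degreeCount p 1 2 : ℝ) ≤ 2 := by exact_mod_cast degreeCount_le p 1 2
    have h5 : (0 : ℝ) ≤ degreeCount p 1 2 := Nat.cast_nonneg _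
    have h6 : 0 ≤ ∑ i ∈ Finset.range 2, 2 * meanReciprocal β μ i :=
      Finset.sum_nonneg fun i _ => mul_nonneg two_pos.le (meanReciprocal_nonneg i)
    rw [abs_le] at h3
    rw [h1, h2, remainderBound, delayError, abs_le]
    constructor <;> linarith
  | succ n hn ih =>
    have h1 := hp.abs_drift_error_le (β := β) (μ := μ) hα hμ (n := n) (by omega)
    have e : (degreeCount p 1 (n + 1) : ℝ) - centering α β μ p (n + 1)
        - compensatedHits α β μ p (n + 1)
        = contraction α β μ n * (degreeCount p 1 n - centering α β μ p n
          - compensatedHits α β μ p n)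
        + ((1 - contraction α β μ n) * degreeCount p 1 n + 1 - leafAttachProb α β μ p n
          - drift α β μ p n) := by
      rw [hp.degreeCount_succ hn, centering_succ α β μ p (by omega), compensatedHits, leafHit,
        leafHitProb, if_neg (show ¬ n < 2 by omega), if_neg (show ¬ n < 2 by omega)]
      ring
    rw [e]
    refine (abs_add_le _ _).trans ?_
    rw [abs_mul, abs_of_nonneg (contraction_nonneg hα n), remainderBound, Finset.sum_range_succ,
      ← add_assoc]
    exact add_le_add ((mul_le_of_le_one_left (abs_nonneg _) (contraction_le_one hα n)).trans ih) h1

theorem mul_one_add_gam (hα : -1 < α) : (2 + α) / (3 + 2 * α) * (1 + gam α) = 1 := by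
  have h1 : 2 + α ≠ 0 := by linarith
  have h2 : 3 + 2 * α ≠ 0 := by linarith
  rw [gam]
  field_simp
  ring

/-- Because `l * (1 + gam α) = 1`, the sequence `n * l` solves the recursion with drift `1` and
contraction `1 - gam α / n`. Replacing these by the true drift and contraction costs at most one
`delayError` each. -/
theorem abs_centering_sub_le (hα : -1 < α) (hμ : ∀ᵐ x ∂μ, 0 ≤ x) (p : ℕ → ℕ) {n : ℕ}
    (hn : 1 ≤ n) :
    |centering α β μ p n - n * ((2 + α) / (3 + 2 * α))| ≤ centeringBound β μ n := by
  set l := (2 + α) / (3 + 2 * α) with hl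
  have hl1 : l * (1 + gam α) = 1 := mul_one_add_gam hα
  have hg := gam_pos hα
  have hl0 : 0 < l := div_pos (by linarith) (by linarith)
  have hlg : l * gam α ≤ 1 := by nlinarith
  have hlg0 : 0 ≤ l * gam α := by positivity
  induction n, hn using Nat.le_induction with
  | base =>
    have h2 := delayError_nonneg (β := β) hμ 0
    have h1 : l ≤ 1 := by nlinarith
    simp only [centering, centeringBound, Finset.Ico_self, Finset.sum_empty, zero_sub, abs_neg,
      Finset.sum_range_one, Nat.cast_one, one_mul]
    rw [abs_of_pos hl0]
    linarith
  | succ n hn ih =>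
    have h1 := abs_drift_sub_one_le (β := β) hα hμ p hn
    have h2 := abs_mul_meanReciprocal_sub_one_le (β := β) hμ hn
    have e : centering α β μ p (n + 1) - ((n + 1 : ℕ) : ℝ) * l
        = contraction α β μ n * (centering α β μ p n - n * l)
        + ((drift α β μ p n - 1) - l * gam α * (n * meanReciprocal β μ n - 1)) := by
      rw [centering_succ α β μ p hn, contraction_eq]
      push_cast
      linear_combination -hl1
    rw [e]
    refine (abs_add_le _ _).trans ?_
    rw [abs_mul, abs_of_nonneg (contraction_nonneg hα n), centeringBound, Finset.sum_range_succ,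
      ← add_assoc]
    refine add_le_add ((mul_le_of_le_one_left (abs_nonneg _) (contraction_le_one hα n)).trans ih) ?_
    refine (abs_sub _ _).trans ?_
    rw [abs_mul, abs_of_nonneg hlg0, delayError]
    have h3 := mul_le_of_le_one_left (abs_nonneg (n * meanReciprocal β μ n - 1)) hlg
    linarith

theorem tendsto_delayError (hβ : β < 1) (hμ : ∀ᵐ x ∂μ, 0 ≤ x)
    (hc : Tendsto (fun n => delayCost β μ n) atTop (𝓝 0)) :
    Tendsto (delayError β μ) atTop (𝓝 0) := by
  have := (hc.add (tendsto_meanReciprocal hμ hc)).add (tendsto_truncProb (μ := μ) hβ)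
  simp only [add_zero] at this
  exact this

theorem tendsto_remainderBound_div_sqrt (hμ : ∀ᵐ x ∂μ, 0 ≤ x)
    (hc : Tendsto (fun n => delayCost β μ n) atTop (𝓝 0)) :
    Tendsto (fun n : ℕ => remainderBound β μ n / √(n : ℝ)) atTop (𝓝 0) := by
  refine tendsto_div_sqrt_of_abs_succ_le (d := fun n => 2 * meanReciprocal β μ n) (n₀ := 0)
    (fun n _ => ?_) ?_
  · rw [abs_of_nonneg (remainderBound_nonneg hμ _), abs_of_nonneg (remainderBound_nonneg hμ _),
      remainderBound, Finset.sum_range_succ, ← add_assoc]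
    exact le_rfl
  · have := (tendsto_sqrt_mul_meanReciprocal hμ hc).const_mul 2
    rw [mul_zero] at this
    exact this.congr fun n => by ring

theorem tendsto_centeringBound_div (hβ : β < 1) (hμ : ∀ᵐ x ∂μ, 0 ≤ x)
    (hc : Tendsto (fun n => delayCost β μ n) atTop (𝓝 0)) :
    Tendsto (fun n : ℕ => centeringBound β μ n / (n : ℝ)) atTop (𝓝 0) := by
  refine tendsto_div_of_abs_succ_le (n₀ := 0) (fun n _ => abs_centeringBound_succ_le hμ n) ?_
  simpa using (tendsto_delayError hβ hμ hc).const_mul 2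

theorem tendsto_centeringBound_div_sqrt (hβ0 : 0 ≤ β) (hβ1 : β < 1) (hμ : ∀ᵐ x ∂μ, 0 ≤ x)
    (hc : Tendsto (fun n => delayCost β μ n) atTop (𝓝 0))
    (hc' : Tendsto (fun n : ℕ => √(n : ℝ) * delayCost β μ n) atTop (𝓝 0)) :
    Tendsto (fun n : ℕ => centeringBound β μ n / √(n : ℝ)) atTop (𝓝 0) := by
  refine tendsto_div_sqrt_of_abs_succ_le (n₀ := 0) (fun n _ => abs_centeringBound_succ_le hμ n) ?_
  have := ((hc'.add (tendsto_sqrt_mul_meanReciprocal hμ hc)).add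
    (tendsto_sqrt_mul_truncProb hμ hβ0 hβ1 hc')).const_mul 2
  simp only [add_zero, mul_zero] at this
  exact this.congr fun n => by rw [delayError]; ring

/-- By the drift identity the hitting probability is `gam α * meanReciprocal β μ n * N` up to small
errors, and `N` differs from `n * l` by `U`, the remainder and the centering error. The only random
term left in the bound is `|U|`. -/
theorem IsParentSequence.abs_leafHitProb_sub_le {p : ℕ → ℕ} (hp : IsParentSequence p)
    (hα : -1 < α) (hμ : ∀ᵐ x ∂μ, 0 ≤ x) {n : ℕ} (hn : 2 ≤ n) :
    |leafHitProb α β μ p n - gam α * ((2 + α) / (3 + 2 * α))|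
      ≤ 4 * delayError β μ n + meanReciprocal β μ n * |compensatedHits α β μ p n|
        + meanReciprocal β μ n * (remainderBound β μ n + centeringBound β μ n) := by
  set l := (2 + α) / (3 + 2 * α) with hl
  have hl1 : l * (1 + gam α) = 1 := mul_one_add_gam hα
  have hg := gam_pos hα
  have hg1 := gam_le_one hα
  have hl0 : 0 < l := div_pos (by linarith) (by linarith)
  have hlg : gam α * l ≤ 1 := by nlinarith
  have hn1 : 1 ≤ n := by omega
  have h1 := hp.abs_drift_error_le (β := β) (μ := μ) hα hμ hn1
  have h2 := abs_drift_sub_one_le (β := β) hα hμ p hn1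
  have h3 := hp.abs_remainder_le (β := β) (μ := μ) hα hμ hn
  have h4 := abs_centering_sub_le (β := β) hα hμ p hn1
  have h5 := abs_mul_meanReciprocal_sub_one_le (β := β) hμ hn1
  have he := meanReciprocal_nonneg (β := β) (μ := μ) n
  have hc := delayCost_nonneg (β := β) hμ n
  have ht := truncProb_nonneg (β := β) (μ := μ) n
  set e := meanReciprocal β μ n
  set N : ℝ := ((degreeCount p 1 n : ℕ) : ℝ)
  set X := centering α β μ p n
  set U := compensatedHits α β μ p n
  have h6 : |N - n * l| ≤ |U| + (remainderBound β μ n + centeringBound β μ n) := by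
    have : N - n * l = U + ((N - X - U) + (X - n * l)) := by ring
    rw [this]
    exact (abs_add_le _ _).trans (add_le_add_right ((abs_add_le _ _).trans (add_le_add h3 h4)) _)
  have e1 : leafHitProb α β μ p n - gam α * l
      = -((1 - contraction α β μ n) * N + 1 - leafAttachProb α β μ p n - drift α β μ p n)
        - (drift α β μ p n - 1) + gam α * (e * (N - n * l)) + gam α * l * (n * e - 1) := by
    rw [leafHitProb, if_neg (by omega), contraction_eq]
    ring
  have h7 : |gam α * (e * (N - n * l))|
      ≤ e * (|U| + (remainderBound β μ n + centeringBound β μ n)) := by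
    rw [abs_mul, abs_mul, abs_of_pos hg, abs_of_nonneg he]
    exact (mul_le_of_le_one_left (by positivity) hg1).trans (mul_le_mul_of_nonneg_left h6 he)
  have h8 : |gam α * l * (n * e - 1)| ≤ |n * e - 1| := by
    rw [abs_mul, abs_of_nonneg (by positivity : 0 ≤ gam α * l)]
    exact mul_le_of_le_one_left (abs_nonneg _) hlg
  rw [e1, delayError]
  refine (abs_add_le _ _).trans ?_
  refine (add_le_add_left (abs_add_le _ _) _).trans ?_
  refine (add_le_add_left (add_le_add_left (abs_sub _ _) _) _).trans ?_
  rw [abs_neg]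
  linarith

end

/-! ### Convergence in distribution -/

/-- Slutsky's theorem, in the simple case where the difference has a deterministic null bound. -/
theorem tendstoInDistribution_of_abs_sub_le {Ω Ω' : Type*} [MeasurableSpace Ω]
    [MeasurableSpace Ω'] {P : Measure Ω} [IsProbabilityMeasure P] {P' : Measure Ω'}
    [IsProbabilityMeasure P'] {X Y : ℕ → Ω → ℝ} {Z : Ω' → ℝ} {b : ℕ → ℝ}
    (hX : TendstoInDistribution X atTop Z (fun _ => P) P') (hb : Tendsto b atTop (𝓝 0))
    (hXY : ∀ᶠ n in atTop, ∀ᵐ ω ∂P, |Y n ω - X n ω| ≤ b n) (hY : ∀ n, AEMeasurable (Y n) P) :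
    TendstoInDistribution Y atTop Z (fun _ => P) P' := by
  refine tendstoInDistribution_of_tendstoInMeasure_sub Y Z hX ?_ hY
  rw [tendstoInMeasure_iff_norm]
  intro ε hε
  refine tendsto_const_nhds.congr' ?_
  filter_upwards [hXY, hb.eventually_lt_const hε] with n h1 h2
  symm
  rw [measure_eq_zero_iff_ae_notMem]
  filter_upwards [h1] with ω h3 h4
  simp only [Pi.sub_apply, Pi.zero_apply, sub_zero, Real.norm_eq_abs] at h4
  linarith

theorem limitVariance_eq {α : ℝ} (hα : -1 < α) :
    limitVariance α = gam α * ((2 + α) / (3 + 2 * α)) * (1 - gam α * ((2 + α) / (3 + 2 * α)))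
      / (1 + 2 * gam α) := by
  have h1 : 2 + α ≠ 0 := by linarith
  have h2 : 3 + 2 * α ≠ 0 := by linarith
  have h3 : 4 + 3 * α ≠ 0 := by linarith
  have e1 : gam α * ((2 + α) / (3 + 2 * α)) = (1 + α) / (3 + 2 * α) := by
    rw [gam]; field_simp
  have e2 : 1 + 2 * gam α = (4 + 3 * α) / (2 + α) := by
    rw [gam]; field_simp; ring
  have e3 : 1 - (1 + α) / (3 + 2 * α) = (2 + α) / (3 + 2 * α) := by
    rw [eq_div_iff h2, sub_mul, div_mul_cancel₀ _ h2]; ring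
  rw [e1, e2, e3, limitVariance]
  field_simp

section

variable {Ω : Type*} [MeasurableSpace Ω] {P : Measure Ω} [IsProbabilityMeasure P] {α β : ℝ}
  {μ : Measure ℝ} [IsProbabilityMeasure μ] {ξ : ℕ → Ω → ℝ} {par : ℕ → Ω → ℕ}

/-- The random term of the pointwise bound has mean at most `√n * meanReciprocal β μ n → 0`. The
deterministic part is `n * meanReciprocal β μ n → 1` times quantities that are `o(n) / n`. -/
theorem IsDelayedNetwork.tendsto_integral_leafHitProb
    (hnet : IsDelayedNetwork P β μ (affine α) ξ par) (hα : -1 < α) (hβ : β < 1)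
    (hμ : ∀ᵐ x ∂μ, 0 ≤ x) (hc : Tendsto (fun n => delayCost β μ n) atTop (𝓝 0)) :
    Tendsto (fun n => ∫ ω, |leafHitProb α β μ (clipParent fun j => par j ω) n
      - gam α * ((2 + α) / (3 + 2 * α))| ∂P) atTop (𝓝 0) := by
  have hrec := hnet.compensatedRecursion hα hμ
  have hbound : Tendsto (fun n : ℕ => 4 * delayError β μ n + √(n : ℝ) * meanReciprocal β μ n
      + (n * meanReciprocal β μ n) *
        (remainderBound β μ n / n + centeringBound β μ n / n)) atTop (𝓝 0) := by
    have h1 : Tendsto (fun n : ℕ => remainderBound β μ n / n) atTop (𝓝 0) := by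
      refine tendsto_div_of_abs_succ_le (d := fun n => 2 * meanReciprocal β μ n) (n₀ := 0)
        (fun n _ => ?_) (by simpa using (tendsto_meanReciprocal hμ hc).const_mul 2)
      rw [abs_of_nonneg (remainderBound_nonneg hμ _), abs_of_nonneg (remainderBound_nonneg hμ _),
        remainderBound, Finset.sum_range_succ, ← add_assoc]
      exact le_rfl
    have := (((tendsto_delayError hβ hμ hc).const_mul 4).add
      (tendsto_sqrt_mul_meanReciprocal hμ hc)).add ((tendsto_mul_meanReciprocal hμ hβ hc).mul
        (h1.add (tendsto_centeringBound_div hβ hμ hc)))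
    simpa using this
  refine squeeze_zero' (Eventually.of_forall fun n => integral_nonneg fun _ => abs_nonneg _) ?_
    hbound
  filter_upwards [eventually_ge_atTop 2] with n hn
  have hn0 : (0 : ℝ) < n := by positivity
  have i1 : Integrable
      (fun ω => |compensatedHits α β μ (clipParent fun j => par j ω) n|) P :=
    integrable_of_measurable_of_norm_le (hrec.measurable_U' n).abs (C := n) fun ω => by
      rw [Real.norm_eq_abs, abs_abs]; exact hrec.abs_U_le n ω
  have i2 : Integrable (fun ω => |leafHitProb α β μ (clipParent fun j => par j ω) n
      - gam α * ((2 + α) / (3 + 2 * α))|) P :=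
    integrable_of_measurable_of_norm_le ((hrec.measurable_q' n).sub_const _).abs
      (C := 1 + |gam α * ((2 + α) / (3 + 2 * α))|) fun ω => by
        rw [Real.norm_eq_abs, abs_abs]
        refine (abs_sub _ _).trans (add_le_add_left ?_ _)
        rw [abs_of_nonneg (hrec.q_nonneg n ω)]
        exact hrec.q_le_one n ω
  have i3 : Integrable (fun ω => 4 * delayError β μ n
      + meanReciprocal β μ n * |compensatedHits α β μ (clipParent fun j => par j ω) n|) P :=
    (integrable_const _).add (i1.const_mul _)
  calc _ ≤ ∫ ω, (4 * delayError β μ n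
        + meanReciprocal β μ n * |compensatedHits α β μ (clipParent fun j => par j ω) n|
        + meanReciprocal β μ n * (remainderBound β μ n + centeringBound β μ n)) ∂P :=
        integral_mono i2 (i3.add (integrable_const _)) fun ω =>
          (isParentSequence_clipParent _).abs_leafHitProb_sub_le hα hμ hn
    _ = 4 * delayError β μ n + meanReciprocal β μ n *
          ∫ ω, |compensatedHits α β μ (clipParent fun j => par j ω) n| ∂P
        + meanReciprocal β μ n * (remainderBound β μ n + centeringBound β μ n) := by
        rw [integral_add i3 (integrable_const _), integral_add (integrable_const _)
          (i1.const_mul _)]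
        simp [integral_const_mul]
    _ ≤ 4 * delayError β μ n + meanReciprocal β μ n * √(n : ℝ)
        + meanReciprocal β μ n * (remainderBound β μ n + centeringBound β μ n) := by
        have := mul_le_mul_of_nonneg_left (hrec.integral_abs_le n)
          (meanReciprocal_nonneg (β := β) (μ := μ) n)
        linarith
    _ = _ := by field_simp

theorem IsDelayedNetwork.tendstoInDistribution_compensatedHits
    (hnet : IsDelayedNetwork P β μ (affine α) ξ par) (hα : -1 < α) (hβ : β < 1)
    (hμ : ∀ᵐ x ∂μ, 0 ≤ x) (hc : Tendsto (fun n => delayCost β μ n) atTop (𝓝 0)) :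
    TendstoInDistribution (fun (n : ℕ) ω =>
        compensatedHits α β μ (clipParent fun j => par j ω) n / √(n : ℝ))
      atTop (fun x : ℝ => x) (fun _ => P) (gaussianReal 0 (limitVariance α).toNNReal) := by
  have hg := gam_pos hα
  have hl0 : 0 < (2 + α) / (3 + 2 * α) := div_pos (by linarith) (by linarith)
  have hl1 := mul_one_add_gam hα
  rw [limitVariance_eq hα]
  refine (hnet.compensatedRecursion hα hμ).tendstoInDistribution hg.le ?_ (by positivity)
    (by nlinarith) (hnet.tendsto_integral_leafHitProb hα hβ hμ hc)
  have := (tendsto_mul_meanReciprocal hμ hβ hc).const_mul (gam α)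
  rw [mul_one] at this
  refine this.congr fun n => ?_
  rw [contraction_eq]
  ring

end

theorem theorem3p6 {Ω : Type*} [MeasurableSpace Ω] (P : Measure Ω) [IsProbabilityMeasure P]
    (α β : ℝ) (hα : -1 < α) (hβ0 : 0 ≤ β) (hβ1 : β < 1)
    (μ : Measure ℝ) [IsProbabilityMeasure μ] (hμ : ∀ᵐ x ∂μ, 0 ≤ x)
    (ξ : ℕ → Ω → ℝ) (par : ℕ → Ω → ℕ)
    (hnet : IsDelayedNetwork P β μ (affine α) ξ par)
    (hdelay : Tendsto (fun n : ℕ => delayCost β μ n) atTop (𝓝 0)) :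
    (∀ᵐ ω ∂P, Tendsto (fun n : ℕ => centering α β μ (fun j => par j ω) n / (n : ℝ)) atTop
      (𝓝 (limitDegree (affine α) 1))) ∧
    TendstoInDistribution
      (fun (n : ℕ) ω => √(n : ℝ) *
        ((degreeCount (fun j => par j ω) 1 n : ℝ) / (n : ℝ)
          - centering α β μ (fun j => par j ω) n / (n : ℝ)))
      atTop (fun x : ℝ => x) (fun _ => P) (gaussianReal 0 (limitVariance α).toNNReal) ∧
    (Tendsto (fun n : ℕ => √(n : ℝ) * delayCost β μ n) atTop (𝓝 0) →
      TendstoInDistribution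
        (fun (n : ℕ) ω => √(n : ℝ) *
          ((degreeCount (fun j => par j ω) 1 n : ℝ) / (n : ℝ) - limitDegree (affine α) 1))
        atTop (fun x : ℝ => x) (fun _ => P) (gaussianReal 0 (limitVariance α).toNNReal)) := by
  rw [limitDegree_affine_one hα]
  have hval := hnet.ae_isParentSequence hμ
  have hclt := hnet.tendstoInDistribution_compensatedHits hα hβ1 hμ hdelay
  have hR := tendsto_remainderBound_div_sqrt hμ hdelay
  have mN : ∀ n, Measurable fun ω => (degreeCount (fun j => par j ω) 1 n : ℝ) := fun n =>
    measurable_from_nat.comp (((isTreeFunction_degreeCount n).measurable par).mono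
      (hnet.treeSigma_le n) le_rfl)
  have mX : ∀ n, Measurable fun ω => centering α β μ (fun j => par j ω) n := fun n =>
    ((isTreeFunction_centering α β μ n).measurable par).mono (hnet.treeSigma_le n) le_rfl
  have hU : ∀ (n : ℕ) (ω : Ω), IsParentSequence (fun j => par j ω) →
      compensatedHits α β μ (clipParent fun j => par j ω) n
        = compensatedHits α β μ (fun j => par j ω) n := fun n ω hω =>
    (isTreeFunction_compensatedHits α hμ n).comp_clipParent hω
  have hdiv : ∀ (n : ℕ) (y : ℝ), 2 ≤ n → √(n : ℝ) * (y / n) = y / √(n : ℝ) := fun n y hn => by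
    have hn0 : (0 : ℝ) < n := by positivity
    have hs : 0 < √(n : ℝ) := Real.sqrt_pos.2 hn0
    have h2 : √(n : ℝ) * √(n : ℝ) = n := Real.mul_self_sqrt hn0.le
    rw [eq_div_iff hs.ne', mul_right_comm, h2, mul_div_cancel₀ _ hn0.ne']
  -- The strong law holds at every sample point, since the centering bound does not depend on the
  -- tree.
  refine ⟨ae_of_all _ fun ω => ?_, ?_, fun hdelay' => ?_⟩
  · rw [tendsto_iff_dist_tendsto_zero]
    refine squeeze_zero' (Eventually.of_forall fun _ => dist_nonneg) ?_
      (tendsto_centeringBound_div hβ1 hμ hdelay)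
    filter_upwards [eventually_ge_atTop 1] with n hn
    have hn0 : (0 : ℝ) < n := by positivity
    rw [Real.dist_eq, le_div_iff₀ hn0]
    nth_rewrite 2 [← abs_of_pos hn0]
    rw [← abs_mul, sub_mul, div_mul_cancel₀ _ hn0.ne', mul_comm _ (n : ℝ)]
    exact abs_centering_sub_le hα hμ _ hn
  · refine tendstoInDistribution_of_abs_sub_le hclt hR ?_ fun n =>
      ((((mN n).div_const _).sub ((mX n).div_const _)).const_mul _).aemeasurable
    filter_upwards [eventually_ge_atTop 2] with n hn
    filter_upwards [hval] with ω hω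
    have hs : 0 < √(n : ℝ) := Real.sqrt_pos.2 (by positivity)
    rw [hU n ω hω, ← sub_div, hdiv n _ hn, ← sub_div, abs_div, abs_of_pos hs]
    exact div_le_div_of_nonneg_right (hω.abs_remainder_le hα hμ hn) hs.le
  -- With the stronger hypothesis both pieces of `N - n p₁ - U = (N - 𝔛 - U) + (𝔛 - n p₁)` are
  -- `o(√n)`.
  · have hRZ := hR.add (tendsto_centeringBound_div_sqrt hβ0 hβ1 hμ hdelay hdelay')
    rw [add_zero] at hRZ
    refine tendstoInDistribution_of_abs_sub_le hclt hRZ ?_ fun n =>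
      ((((mN n).div_const _).sub_const _).const_mul _).aemeasurable
    filter_upwards [eventually_ge_atTop 2] with n hn
    filter_upwards [hval] with ω hω
    have hn0 : (0 : ℝ) < n := by positivity
    have hs : 0 < √(n : ℝ) := Real.sqrt_pos.2 hn0
    have e : (degreeCount (fun j => par j ω) 1 n : ℝ) / n - (2 + α) / (3 + 2 * α)
        = (degreeCount (fun j => par j ω) 1 n - n * ((2 + α) / (3 + 2 * α))) / n := by
      field_simp
    rw [hU n ω hω, e, hdiv n _ hn, ← sub_div, abs_div, abs_of_pos hs, ← add_div]
    refine div_le_div_of_nonneg_right ?_ hs.le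
    refine le_trans (le_of_eq ?_) ((abs_add_le _ _).trans
      (add_le_add (hω.abs_remainder_le hα hμ hn)
        (abs_centering_sub_le hα hμ (fun j => par j ω) (by omega))))
    congr 1
    ring
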